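/- Let $\mathbb S^1=\mathbb R/\mathbb Z$ carry its quotient metric $d$ and its uniform (normalised Lebesgue) probability measure $\lambda$, and let $\mathscr P(\mathbb S^1)$ be the set of Borel probability measures on $\mathbb S^1$, with the quadratic Wasserstein distance \[W_2(\mu,\nu)=\Big(\inf_\Pi\int_{\mathbb S^1\times\mathbb S^1} d(x,y)^2\,\Pi(dx\,dy)\Big)^{1/2},\] where the infimum is over all Borel measures $\Pi$ on $\mathbb S^1\times\mathbb S^1$ with marginals $\mu$ and $\nu$. For a Borel map $\Phi:\mathbb S^1\to\mathbb S^1$ let $\Phi_\#\mu(A)=\mu(\Phi^{-1}A)$ be the push-forward, and let $B^n$ be the closed unit Euclidean ball of $\mathbb R^n$ centered at $0$. Let $\Phi:\mathbb S^1\to\mathbb S^1$ be a $C^2$ expanding map, i.e. $|\Phi'|>1$ everywhere. Then $\Phi$ has a unique invariant Borel probability measure $\rho\lambda$ that is absolutely continuous with respect to $\lambda$. Moreover, for every integer $n\ge 0$ there is a map $F:B^n\to\mathscr P(\mathbb S^1)$ such that: 1. $F$ is a bi-Lipschitz embedding: there are $c,C>0$ with $c|a-b|\le W_2(F(a),F(b))\le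 C|a-b|$ for all $a,b\in B^n$; 2. $F(0)=\rho\lambda$; 3. $W_2\big(\Phi_\#(F(a)),F(a)\big)=o(|a|)$ as $a\to 0$ in $B^n$; 4. as a consequence of the above, for every $\varepsilon>0$ and every integer $K\ge 0$ there is $r>0$ such that $W_2\big(\Phi_\#^k(F(a)),F(a)\big)\le\varepsilon|a|$ for all integers $0\le k\le K$ and all $a\in B^n$ with $|a|<r$. -/

import Mathlib

open MeasureTheory Filter Topology Asymptotics
open scoped ENNReal

/-- A Borel measure `π` on `X × X` is a transport plan (coupling) between `μ` and `ν` when its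
first marginal is `μ` and its second marginal is `ν`. -/
def IsTransportPlan {X : Type*} [MeasurableSpace X] (μ ν : Measure X)
    (π : Measure (X × X)) : Prop :=
  π.map Prod.fst = μ ∧ π.map Prod.snd = ν

/-- The quadratic Wasserstein distance
`W₂(μ, ν) = (inf_π ∫ d(x, y)² dπ(x, y))^{1/2}`, the infimum being over all transport plans.
On a space of finite diameter the infimum is finite for probability measures `μ`, `ν`. -/
noncomputable def wasserstein {X : Type*} [MeasurableSpace X] [PseudoEMetricSpace X]
    (μ ν : Measure X) : ℝ :=
  Real.sqrt
    (⨅ (π : Measure (X × X)) (_ : IsTransportPlan μ ν π),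
      ∫⁻ p, (edist p.1 p.2) ^ 2 ∂π).toReal

/-- `Φ` is a `C²` expanding map of the circle `ℝ/ℤ`: it lifts to a `C²` function `f : ℝ → ℝ`
with `|f'| > 1` everywhere (`f'` is then the `1`-periodic lift of `Φ'`). -/
def IsC2Expanding (Φ : UnitAddCircle → UnitAddCircle) : Prop :=
  ∃ f : ℝ → ℝ, ContDiff ℝ 2 f ∧ (∀ x : ℝ, Φ (x : UnitAddCircle) = (f x : UnitAddCircle)) ∧
    ∀ x : ℝ, 1 < |deriv f x|

/-- `μ` is an absolutely continuous (with respect to the uniform measure `λ`, the normalised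
Lebesgue measure of `ℝ/ℤ`) invariant measure of `Φ`. -/
def IsACInvariant (Φ : UnitAddCircle → UnitAddCircle) (μ : Measure UnitAddCircle) : Prop :=
  μ ≪ (volume : Measure UnitAddCircle) ∧ μ.map Φ = μ

/-- `F` restricted to the set `s` is a bi-Lipschitz embedding into the space of Borel
probability measures of the circle endowed with the quadratic Wasserstein distance. -/
def IsBiLipschitzEmbeddingOn {E : Type*} [NormedAddCommGroup E]
    (F : E → ProbabilityMeasure UnitAddCircle) (s : Set E) : Prop :=
  ∃ c > (0 : ℝ), ∃ C > (0 : ℝ), ∀ a ∈ s, ∀ b ∈ s,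
    c * ‖a - b‖ ≤ wasserstein (F a : Measure UnitAddCircle) (F b) ∧
      wasserstein (F a : Measure UnitAddCircle) (F b) ≤ C * ‖a - b‖

/-!
# Displacement families of almost invariant measures of an expanding circle map

**The invariant density.** Let `f` be a lift of the map, `ψ` its inverse and `D ≥ 2` the absolute
value of the degree. The transfer operator, which sends `φ` to the function
`y ↦ ∑ j < D, |ψ' (y + j)| φ (ψ (y + j))`, maps the cone of densities with `K`-Lipschitz
logarithm, `K` large, into a smaller cone of the same kind, because the inverse branches
contract and `log |ψ'|` is Lipschitz. A function of the smaller cone dominates a constant function, and subtracting it does not leave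
the larger cone; so two densities share a fixed proportion of their mass after each step and the
iterates converge exponentially fast to a positive continuous invariant density `ρ`
(`ExpandingLift.abs_transfer_pow_sub_le`, `ExpandingLift.exists_invariant_density`). Lipschitz
functions are dense in `L¹`, and the push-forward does not increase the total variation, so `ρ` is
the only invariant density (`ExpandingLift.eq_circleMeasure_of_isACInvariant`).

**The vector fields.** Displacing `ρ λ` along a field `v` creates the flux `u = ρ v`, and to first
order the map carries `u` to `± ∑ j < D, u (ψ (y + j))`. Fields with invariant flux are abundant:
the operator `v ↦ (v ∘ f) / f'` is a contraction, so `v = w + (v ∘ f) / f'` has a continuous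
solution for every continuous `w`, and its flux is invariant as soon as the sums of `ρ w` over the
fibres vanish. A constant flux is multiplied by the degree, so no nontrivial combination of
independent such fields has constant flux (`ExpandingLift.exists_invariant_fields`). Take `F a` to
be the image of `ρ λ` under the displacement `x ↦ x + δ ∑ i, a i * v i x`.

**Almost invariance.** A measure on the circle is described by its lifted cumulative distribution
function `N`, defined up to a constant. Displacement along a small continuous field lowers `N` by
the flux, up to an error `o(‖a‖)`, although the displacement need not be monotone
(`IsLogLipschitzDensity.exists_isApproxCDF`). The map acts on `N` by the same finite sum as on
fluxes (`ExpandingLift.isApproxCDF_comp`), so boundedly many push-forwards of `F a` have the same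
`N` up to `o(‖a‖)`. As `ρ` is bounded below, the quantile coupling then moves every point by
`o(‖a‖)` (`IsApproxCDF.wasserstein_le`). This compares every one of them with `F a` directly,
without the triangle inequality for the Wasserstein distance.

**Bi-Lipschitz bounds.** The upper bound is the obvious coupling. For the lower one, the primitive
of the centred flux of `a - b` is a Lipschitz test function, of Lipschitz constant `O(‖a - b‖)`,
whose integrals against `F a` and `F b` differ by about `δ` times the variance of that flux over a
period, which is a positive definite quadratic form in `a - b`
(`IsLogLipschitzDensity.exists_le_wasserstein_displacedMeasure`).
-/

/-! ### Wasserstein distance, lifted distribution functions and the quantile coupling -/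

section Wasserstein

variable {X : Type*} [PseudoMetricSpace X] [SecondCountableTopology X] [MeasurableSpace X]
  [OpensMeasurableSpace X]

/-- Two random variables at distance at most `s` form a transport plan of cost at most `s²`. -/
theorem wasserstein_map_le {Ω : Type*} [MeasurableSpace Ω] {m : Measure Ω}
    [IsProbabilityMeasure m] {T₁ T₂ : Ω → X} (h₁ : Measurable T₁) (h₂ : Measurable T₂) {s : ℝ}
    (hs : 0 ≤ s) (h : ∀ᵐ ω ∂m, dist (T₁ ω) (T₂ ω) ≤ s) :
    wasserstein (m.map T₁) (m.map T₂) ≤ s := by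
  have hT : Measurable fun ω => (T₁ ω, T₂ ω) := h₁.prodMk h₂
  have hplan : IsTransportPlan (m.map T₁) (m.map T₂) (m.map fun ω => (T₁ ω, T₂ ω)) := by
    constructor
    · rw [Measure.map_map measurable_fst hT]; rfl
    · rw [Measure.map_map measurable_snd hT]; rfl
  have hcost : ∫⁻ p, (edist p.1 p.2) ^ 2 ∂(m.map fun ω => (T₁ ω, T₂ ω)) ≤
      ENNReal.ofReal (s ^ 2) := by
    rw [lintegral_map (by fun_prop) hT]
    calc ∫⁻ ω, (edist (T₁ ω) (T₂ ω)) ^ 2 ∂m ≤ ∫⁻ _, ENNReal.ofReal (s ^ 2) ∂m := by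
          refine lintegral_mono_ae (h.mono fun ω hω => ?_)
          rw [edist_dist, ← ENNReal.ofReal_pow dist_nonneg]
          exact ENNReal.ofReal_le_ofReal (pow_le_pow_left₀ dist_nonneg hω 2)
      _ = _ := by simp
  unfold wasserstein
  refine Real.sqrt_le_iff.2 ⟨hs, ?_⟩
  exact ENNReal.toReal_le_of_le_ofReal (sq_nonneg s) ((iInf₂_le _ hplan).trans hcost)

/-- The easy half of Kantorovich duality: a Lipschitz function integrates to almost the same value
against measures which are close in the Wasserstein distance. -/
theorem abs_integral_sub_integral_le_wasserstein [CompactSpace X] {μ ν : Measure X}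
    [IsProbabilityMeasure μ] [IsProbabilityMeasure ν] {φ : X → ℝ} {L : ℝ} (hL : 0 < L)
    (hφc : Continuous φ) (hφ : ∀ x y, |φ x - φ y| ≤ L * dist x y) :
    |∫ x, φ x ∂μ - ∫ x, φ x ∂ν| ≤ L * wasserstein μ ν := by
  have hdc : Continuous fun p : X × X => dist p.1 p.2 := continuous_dist
  have key : ∀ π : Measure (X × X), IsTransportPlan μ ν π →
      ENNReal.ofReal ((|∫ x, φ x ∂μ - ∫ x, φ x ∂ν| / L) ^ 2) ≤
        ∫⁻ p, (edist p.1 p.2) ^ 2 ∂π := by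
    rintro π ⟨h₁, h₂⟩
    have hπ : IsProbabilityMeasure π := by
      constructor
      have : (π.map Prod.fst) Set.univ = 1 := by rw [h₁]; exact measure_univ
      rwa [Measure.map_apply measurable_fst MeasurableSet.univ, Set.preimage_univ] at this
    have bdd : ∀ g : X × X → ℝ, Continuous g → Integrable g π := fun g hg =>
      hg.integrable_of_hasCompactSupport (HasCompactSupport.of_compactSpace g)
    have hd := bdd _ hdc
    have hd2 : Integrable (fun p : X × X => dist p.1 p.2 ^ 2) π := bdd _ (hdc.pow 2)
    have e₁ : ∫ x, φ x ∂μ = ∫ p, φ p.1 ∂π := by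
      rw [← h₁, integral_map measurable_fst.aemeasurable hφc.aestronglyMeasurable]
    have e₂ : ∫ x, φ x ∂ν = ∫ p, φ p.2 ∂π := by
      rw [← h₂, integral_map measurable_snd.aemeasurable hφc.aestronglyMeasurable]
    have hA : |∫ x, φ x ∂μ - ∫ x, φ x ∂ν| / L ≤ ∫ p, dist p.1 p.2 ∂π := by
      rw [div_le_iff₀' hL, e₁, e₂, ← integral_sub (bdd _ (by fun_prop)) (bdd _ (by fun_prop)),
        ← integral_const_mul]
      refine (abs_integral_le_integral_abs).trans (integral_mono ?_ (hd.const_mul L) ?_)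
      · exact bdd _ (by fun_prop)
      · exact fun p => hφ p.1 p.2
    -- the variance of the distance is nonnegative
    have hJ : (∫ p, dist p.1 p.2 ∂π) ^ 2 ≤ ∫ p, dist p.1 p.2 ^ 2 ∂π := by
      set c := ∫ p, dist p.1 p.2 ∂π with hc
      have h0 : 0 ≤ ∫ p, (dist p.1 p.2 - c) ^ 2 ∂π := integral_nonneg fun p => sq_nonneg _
      have h1 : ∫ p, (dist p.1 p.2 - c) ^ 2 ∂π = ∫ p, dist p.1 p.2 ^ 2 ∂π - c ^ 2 := by
        have : ∀ p : X × X, (dist p.1 p.2 - c) ^ 2 =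
            dist p.1 p.2 ^ 2 - 2 * c * dist p.1 p.2 + c ^ 2 := fun p => by ring
        simp_rw [this]
        rw [integral_add (f := fun p : X × X => dist p.1 p.2 ^ 2 - 2 * c * dist p.1 p.2)
          (hd2.sub (hd.const_mul _)) (integrable_const _),
          integral_sub hd2 (hd.const_mul _), integral_const_mul, ← hc]
        simp
        ring
      linarith
    calc ENNReal.ofReal ((|∫ x, φ x ∂μ - ∫ x, φ x ∂ν| / L) ^ 2)
        ≤ ENNReal.ofReal (∫ p, dist p.1 p.2 ^ 2 ∂π) :=
          ENNReal.ofReal_le_ofReal ((pow_le_pow_left₀ (by positivity) hA 2).trans hJ)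
      _ = ∫⁻ p, (edist p.1 p.2) ^ 2 ∂π := by
          rw [ofReal_integral_eq_lintegral_ofReal hd2 (ae_of_all _ fun p => sq_nonneg _)]
          refine lintegral_congr fun p => ?_
          rw [edist_dist, ENNReal.ofReal_pow dist_nonneg]
  -- the product plan makes the infimum finite, so `toReal` does not collapse it to `0`
  have hfin : (⨅ (π : Measure (X × X)) (_ : IsTransportPlan μ ν π),
      ∫⁻ p, (edist p.1 p.2) ^ 2 ∂π) ≠ ⊤ := by
    have hplan : IsTransportPlan μ ν (μ.prod ν) := ⟨by simp, by simp⟩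
    refine ((iInf₂_le _ hplan).trans_lt ?_).ne
    have hint : Integrable (fun p : X × X => dist p.1 p.2 ^ 2) (μ.prod ν) :=
      (hdc.pow 2).integrable_of_hasCompactSupport (HasCompactSupport.of_compactSpace _)
    refine lt_of_eq_of_lt (lintegral_congr fun p => ?_) hint.lintegral_lt_top
    rw [edist_dist, ENNReal.ofReal_pow dist_nonneg]
  have := (ENNReal.ofReal_le_iff_le_toReal hfin).1 (le_iInf₂ key)
  rw [← div_le_iff₀' hL]
  exact Real.le_sqrt_of_sq_le this

end Wasserstein

section Coupling

theorem dist_coe_le (x y : ℝ) : dist (x : UnitAddCircle) (y : UnitAddCircle) ≤ |x - y| := by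
  rw [dist_eq_norm, ← AddCircle.coe_sub, UnitAddCircle.norm_eq]
  simpa using round_le (x - y) 0

variable {Ω : Type} [MeasurableSpace Ω]

/-- For `t` uniformly distributed over a period, `⌊h - t⌋` has mean `h - 1`. -/
theorem integral_floor_sub_mul {ρ : ℝ → ℝ} (hρ : Continuous ρ) (hper : Function.Periodic ρ 1)
    (hmass : ∫ t in (0 : ℝ)..1, ρ t = 1) (h : ℝ) :
    ∫ t in Set.Ioc (0 : ℝ) 1, (⌊h - t⌋ : ℝ) * ρ t = (∫ t in (0 : ℝ)..h, ρ t) - 1 := by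
  have hint : ∀ a b, IntervalIntegrable ρ volume a b := fun a b => hρ.intervalIntegrable a b
  set r := Int.fract h with hr
  have hr0 : 0 ≤ r := Int.fract_nonneg h
  have hr1 : r < 1 := Int.fract_lt_one h
  have hh : h = ⌊h⌋ + r := (Int.floor_add_fract h).symm
  have e1 : ∫ t in Set.Ioc (0 : ℝ) 1, (⌊h - t⌋ : ℝ) * ρ t
      = ∫ t in (0 : ℝ)..1, (⌊h - t⌋ : ℝ) * ρ t := by
    rw [intervalIntegral.integral_of_le zero_le_one]
  have c1 : Set.EqOn (fun t => (⌊h - t⌋ : ℝ) * ρ t) (fun t => (⌊h⌋ : ℝ) * ρ t)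
      (Set.uIoc 0 r) := by
    intro t ht
    rw [Set.uIoc_of_le hr0] at ht
    have : ⌊h - t⌋ = ⌊h⌋ := by
      rw [Int.floor_eq_iff]
      constructor <;> linarith [ht.1, ht.2]
    simp only [this]
  have c2 : Set.EqOn (fun t => (⌊h - t⌋ : ℝ) * ρ t) (fun t => ((⌊h⌋ : ℝ) - 1) * ρ t)
      (Set.uIoc r 1) := by
    intro t ht
    rw [Set.uIoc_of_le hr1.le] at ht
    have : ⌊h - t⌋ = ⌊h⌋ - 1 := by
      rw [Int.floor_eq_iff]
      push_cast
      constructor <;> linarith [ht.1, ht.2]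
    simp only [this]
    push_cast
    ring
  have i1 : IntervalIntegrable (fun t => (⌊h - t⌋ : ℝ) * ρ t) volume 0 r :=
    ((hint 0 r).const_mul _).congr fun t ht => (c1 ht).symm
  have i2 : IntervalIntegrable (fun t => (⌊h - t⌋ : ℝ) * ρ t) volume r 1 :=
    ((hint r 1).const_mul _).congr fun t ht => (c2 ht).symm
  rw [e1, ← intervalIntegral.integral_add_adjacent_intervals i1 i2,
    intervalIntegral.integral_congr_ae (ae_of_all _ c1),
    intervalIntegral.integral_congr_ae (ae_of_all _ c2),
    intervalIntegral.integral_const_mul, intervalIntegral.integral_const_mul]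
  have s1 : (∫ t in (0 : ℝ)..r, ρ t) + ∫ t in r..1, ρ t = 1 := by
    rw [intervalIntegral.integral_add_adjacent_intervals (hint _ _) (hint _ _), hmass]
  have s2 : ∫ t in (0 : ℝ)..h, ρ t = ⌊h⌋ + ∫ t in (0 : ℝ)..r, ρ t := by
    have := hper.intervalIntegral_add_zsmul_eq ⌊h⌋ 0 (fun a b => hint a b)
    have h2 : ∫ t in (⌊h⌋ : ℝ)..h, ρ t = ∫ t in (0 : ℝ)..r, ρ t := by
      have h3 := intervalIntegral.integral_comp_add_right (a := 0) (b := r) ρ (⌊h⌋ : ℝ)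
      rw [zero_add, add_comm r, ← hh] at h3
      rw [← h3]
      refine intervalIntegral.integral_congr fun t _ => ?_
      have := hper.int_mul ⌊h⌋ t
      rw [mul_one] at this
      exact this
    rw [← intervalIntegral.integral_add_adjacent_intervals (hint 0 ⌊h⌋) (hint ⌊h⌋ h), h2]
    simp only [zero_add, zsmul_eq_mul, mul_one, hmass] at this
    rw [this]
  rw [s2]
  linear_combination ((⌊h⌋ : ℝ) - 1) * s1

/-- The law of a real random variable modulo `1` is determined by the differences of its lifted
cumulative distribution function `y ↦ 𝔼 ⌊y - g⌋`. -/
theorem map_coe_eq_of_integral_floor_eq {Ω₁ Ω₂ : Type} [MeasurableSpace Ω₁] [MeasurableSpace Ω₂]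
    {m₁ : Measure Ω₁} {m₂ : Measure Ω₂} [IsProbabilityMeasure m₁] [IsProbabilityMeasure m₂]
    {g₁ : Ω₁ → ℝ} {g₂ : Ω₂ → ℝ} (h₁ : Measurable g₁) (h₂ : Measurable g₂)
    (i₁ : ∀ y : ℝ, Integrable (fun ω => (⌊y - g₁ ω⌋ : ℝ)) m₁)
    (i₂ : ∀ y : ℝ, Integrable (fun ω => (⌊y - g₂ ω⌋ : ℝ)) m₂) (c : ℝ)
    (h : ∀ y : ℝ, ∫ ω, (⌊y - g₁ ω⌋ : ℝ) ∂m₁ = ∫ ω, (⌊y - g₂ ω⌋ : ℝ) ∂m₂ + c) :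
    m₁.map (fun ω => (g₁ ω : UnitAddCircle)) = m₂.map (fun ω => (g₂ ω : UnitAddCircle)) := by
  -- the representative in `(0, 1]`
  set t : ℝ → ℝ := fun x => x - ⌈x⌉ + 1 with ht
  have tm : Measurable t := by fun_prop
  have t0 : ∀ x, 0 < t x := fun x => by
    have := Int.ceil_lt_add_one x
    simp only [ht]; linarith
  have t1 : ∀ x, t x ≤ 1 := fun x => by
    have := Int.le_ceil x
    simp only [ht]; linarith
  have tcoe : ∀ x : ℝ, ((t x : ℝ) : UnitAddCircle) = x := fun x => by
    have h1 : x - t x = (⌈x⌉ - 1 : ℤ) • (1 : ℝ) := by simp only [ht, zsmul_eq_mul]; push_cast; ring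
    have h2 : ((x - t x : ℝ) : UnitAddCircle) = 0 := by
      rw [h1, AddCircle.coe_zsmul, AddCircle.coe_period, smul_zero]
    rw [AddCircle.coe_sub, sub_eq_zero] at h2
    exact h2.symm
  -- the difference of two floors is the indicator of an arc
  have tfl : ∀ x y : ℝ, 0 < y → y < 1 →
      Set.indicator (t ⁻¹' Set.Iic y) (fun _ => (1 : ℝ)) x = (⌊y - x⌋ : ℝ) - ⌊0 - x⌋ := by
    intro x y hy0 hy1
    have e0 : ⌊0 - x⌋ = -⌈x⌉ := by rw [zero_sub, Int.floor_neg]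
    have hx : x = t x + (⌈x⌉ - 1) := by simp [ht]
    by_cases hxy : t x ≤ y
    · have : ⌊y - x⌋ = 1 - ⌈x⌉ := by
        rw [Int.floor_eq_iff]; push_cast
        constructor <;> linarith [t0 x]
      rw [Set.indicator_of_mem (show x ∈ t ⁻¹' Set.Iic y from hxy), e0, this]
      push_cast; ring
    · have : ⌊y - x⌋ = - ⌈x⌉ := by
        rw [Int.floor_eq_iff]; push_cast
        constructor <;> linarith [t1 x, not_le.1 hxy]
      rw [Set.indicator_of_notMem (show x ∉ t ⁻¹' Set.Iic y from hxy), e0, this]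
      push_cast; ring
  have meas : ∀ {Ω' : Type} [MeasurableSpace Ω'] (m : Measure Ω') [IsProbabilityMeasure m]
      (g : Ω' → ℝ), Measurable g → (∀ y : ℝ, Integrable (fun ω => (⌊y - g ω⌋ : ℝ)) m) →
      ∀ y, 0 < y → y < 1 → m.real (g ⁻¹' (t ⁻¹' Set.Iic y)) =
        ∫ ω, (⌊y - g ω⌋ : ℝ) ∂m - ∫ ω, (⌊0 - g ω⌋ : ℝ) ∂m := by
    intro Ω' _ m _ g hg hi y hy0 hy1
    rw [← integral_sub (hi y) (hi 0)]
    refine (integral_indicator_one (μ := m) ((tm.comp hg) measurableSet_Iic)).symm.trans ?_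
    exact integral_congr_ae (ae_of_all _ fun ω => tfl (g ω) y hy0 hy1)
  have hreal : m₁.map (t ∘ g₁) = m₂.map (t ∘ g₂) := by
    have p₁ : IsProbabilityMeasure (m₁.map (t ∘ g₁)) :=
      Measure.isProbabilityMeasure_map (tm.comp h₁).aemeasurable
    have p₂ : IsProbabilityMeasure (m₂.map (t ∘ g₂)) :=
      Measure.isProbabilityMeasure_map (tm.comp h₂).aemeasurable
    refine Measure.ext_of_Iic _ _ fun y => ?_
    rw [Measure.map_apply (tm.comp h₁) measurableSet_Iic,
      Measure.map_apply (tm.comp h₂) measurableSet_Iic]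
    rcases le_or_gt y 0 with hy0 | hy0
    · have e : ∀ {Ω' : Type} (g : Ω' → ℝ), (t ∘ g) ⁻¹' Set.Iic y = ∅ := fun g => by
        ext ω
        simp only [Set.mem_preimage, Set.mem_Iic, Function.comp, Set.mem_empty_iff_false,
          iff_false, not_le]
        exact hy0.trans_lt (t0 _)
      rw [e, e]; simp
    rcases le_or_gt 1 y with hy1 | hy1
    · have e : ∀ {Ω' : Type} (g : Ω' → ℝ), (t ∘ g) ⁻¹' Set.Iic y = Set.univ := fun g => by
        ext ω
        simp only [Set.mem_preimage, Set.mem_Iic, Function.comp, Set.mem_univ, iff_true]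
        exact (t1 _).trans hy1
      rw [e, e]; simp
    · have a := meas m₁ g₁ h₁ i₁ y hy0 hy1
      have b := meas m₂ g₂ h₂ i₂ y hy0 hy1
      have : m₁.real (g₁ ⁻¹' (t ⁻¹' Set.Iic y)) = m₂.real (g₂ ⁻¹' (t ⁻¹' Set.Iic y)) := by
        rw [a, b, h y, h 0]; ring
      exact (measureReal_eq_measureReal_iff).1 this
  have hc : Measurable fun x : ℝ => (x : UnitAddCircle) := AddCircle.measurable_mk'
  have push : ∀ {Ω' : Type} [MeasurableSpace Ω'] (m : Measure Ω') (g : Ω' → ℝ), Measurable g →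
      m.map (fun ω => (g ω : UnitAddCircle)) =
        (m.map (t ∘ g)).map (fun x : ℝ => (x : UnitAddCircle)) := by
    intro Ω' _ m g hg
    rw [Measure.map_map hc (tm.comp hg)]
    congr 1
    ext ω
    exact (tcoe (g ω)).symm
  exact (push m₁ g₁ h₁).trans ((congrArg _ hreal).trans (push m₂ g₂ h₂).symm)

/-- The lifted cumulative distribution function `y ↦ 𝔼 ⌊y - g⌋` of a real random variable `g`,
seen modulo `1`. For `0 ≤ a ≤ b ≤ a + 1` its increment from `a` to `b` is the probability that
`g` modulo `1` lies in the arc `(a, b]`. -/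
noncomputable def liftedCDF (m : Measure Ω) (g : Ω → ℝ) (y : ℝ) : ℝ :=
  ∫ ω, (⌊y - g ω⌋ : ℝ) ∂m

variable {m : Measure Ω} [IsProbabilityMeasure m] {g : Ω → ℝ}

theorem integrable_floor_sub (hg : Measurable g) (hi : Integrable g m) (y : ℝ) :
    Integrable (fun ω => (⌊y - g ω⌋ : ℝ)) m := by
  refine Integrable.mono' (g := fun ω => |y - g ω| + 1)
    (((integrable_const y).sub hi).abs.add (integrable_const 1))
    (Measurable.aestronglyMeasurable (by fun_prop)) (ae_of_all _ fun ω => ?_)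
  rw [Real.norm_eq_abs, abs_le]
  have h1 := Int.floor_le (y - g ω)
  have h2 := Int.lt_floor_add_one (y - g ω)
  have h3 := neg_abs_le (y - g ω)
  have h4 := le_abs_self (y - g ω)
  constructor <;> linarith

theorem liftedCDF_mono (hg : Measurable g) (hi : Integrable g m) : Monotone (liftedCDF m g) := by
  intro a b hab
  refine integral_mono (integrable_floor_sub hg hi a) (integrable_floor_sub hg hi b) fun ω => ?_
  exact Int.cast_le.2 (Int.floor_mono (by linarith))

theorem liftedCDF_add_int (hg : Measurable g) (hi : Integrable g m) (y : ℝ) (k : ℤ) :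
    liftedCDF m g (y + k) = liftedCDF m g y + k := by
  have : ∀ ω, ((⌊y + k - g ω⌋ : ℤ) : ℝ) = (⌊y - g ω⌋ : ℝ) + k := fun ω => by
    rw [show y + k - g ω = y - g ω + k by ring, Int.floor_add_intCast]; push_cast; rfl
  unfold liftedCDF
  simp_rw [this]
  rw [integral_add (integrable_floor_sub hg hi y) (integrable_const _)]
  simp

theorem liftedCDF_rightContinuous (hg : Measurable g) (hi : Integrable g m) (y : ℝ) :
    ContinuousWithinAt (liftedCDF m g) (Set.Ici y) y := by
  refine continuousWithinAt_of_dominated (bound := fun ω => |y - g ω| + 2)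
    (Eventually.of_forall fun z => Measurable.aestronglyMeasurable (by fun_prop)) ?_
    (((integrable_const y).sub hi).abs.add (integrable_const 2)) (ae_of_all _ fun ω => ?_)
  · have : ∀ᶠ z in 𝓝[≥] y, z < y + 1 :=
      nhdsWithin_le_nhds (eventually_lt_nhds (by linarith))
    filter_upwards [this, self_mem_nhdsWithin] with z hz hz'
    have hz'' : y ≤ z := hz'
    refine ae_of_all _ fun ω => ?_
    rw [Real.norm_eq_abs, abs_le]
    have h1 := Int.floor_le (z - g ω)
    have h2 := Int.lt_floor_add_one (z - g ω)
    have h3 := neg_abs_le (y - g ω)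
    have h4 := le_abs_self (y - g ω)
    constructor <;> linarith
  · have hlt : y < g ω + ⌊y - g ω⌋ + 1 := by linarith [Int.lt_floor_add_one (y - g ω)]
    have hev : ∀ᶠ z in 𝓝[≥] y, (⌊y - g ω⌋ : ℝ) = ⌊z - g ω⌋ := by
      filter_upwards [nhdsWithin_le_nhds (eventually_lt_nhds hlt),
        self_mem_nhdsWithin] with z hz hz'
      have hz'' : y ≤ z := hz'
      have : ⌊z - g ω⌋ = ⌊y - g ω⌋ := by
        rw [Int.floor_eq_iff]
        constructor <;> linarith [Int.floor_le (y - g ω)]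
      rw [this]
    exact tendsto_const_nhds.congr' hev

/-- Quantile coupling: a random variable `Q` on the unit interval with the lifted cumulative
distribution function of `g`, up to a constant. -/
theorem exists_quantile (hg : Measurable g) (hi : Integrable g m) (c : ℝ) :
    ∃ Q : ℝ → ℝ, Measurable Q ∧ (∀ u y : ℝ, Q u ≤ y ↔ u ≤ liftedCDF m g y + c) ∧
      (volume.restrict (Set.Ioc (0 : ℝ) 1)).map (fun u => (Q u : UnitAddCircle)) =
        m.map fun ω => (g ω : UnitAddCircle) := by
  set N : ℝ → ℝ := fun y => liftedCDF m g y + c with hN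
  have Nmono : Monotone N := fun a b hab => add_le_add_left (liftedCDF_mono hg hi hab) c
  have Nint : ∀ y (k : ℤ), N (y + k) = N y + k := fun y k => by
    simp only [hN, liftedCDF_add_int hg hi]; ring
  have Nright : ∀ y, ContinuousWithinAt N (Set.Ici y) y := fun y =>
    (liftedCDF_rightContinuous hg hi y).add continuousWithinAt_const
  set Q : ℝ → ℝ := fun u => sInf {y | u ≤ N y} with hQ
  have hne : ∀ u, {y | u ≤ N y}.Nonempty := fun u => by
    refine ⟨0 + ⌈u - N 0⌉, ?_⟩
    rw [Set.mem_ofPred_eq, Nint]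
    linarith [Int.le_ceil (u - N 0)]
  have hbdd : ∀ u, BddBelow {y | u ≤ N y} := fun u => by
    refine ⟨0 + (⌊u - N 0⌋ - 1 : ℤ), fun y hy => ?_⟩
    by_contra! hlt
    have h1 := Nmono hlt.le
    rw [Nint] at h1
    have h2 : u ≤ N y := hy
    push_cast at h1
    linarith [Int.floor_le (u - N 0)]
  have hQiff : ∀ u y, Q u ≤ y ↔ u ≤ N y := by
    refine fun u y => ⟨fun h => ?_, fun h => csInf_le (hbdd u) h⟩
    refine le_trans ?_ (Nmono h)
    have hc : ContinuousWithinAt N (Set.Ioi (Q u)) (Q u) :=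
      (Nright (Q u)).mono Set.Ioi_subset_Ici_self
    refine ge_of_tendsto hc ?_
    filter_upwards [self_mem_nhdsWithin] with z hz
    obtain ⟨w, hw, hwz⟩ := exists_lt_of_csInf_lt (hne u) hz
    exact le_trans hw (Nmono hwz.le)
  have Qmono : Monotone Q := fun u u' h => (hQiff _ _).2 (h.trans ((hQiff _ _).1 le_rfl))
  -- `⌊y - Q⌋` is the floor of `N y` minus a uniform variable, whose mean is `N y - 1`
  have Qfl : ∀ y u, ⌊y - Q u⌋ = ⌊N y - u⌋ := by
    refine fun y u => eq_of_forall_le_iff fun k => ?_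
    rw [Int.le_floor, Int.le_floor, le_sub_comm, hQiff]
    have := Nint y (-k)
    push_cast at this
    rw [sub_eq_add_neg y, this]
    constructor <;> intro <;> linarith
  have : IsProbabilityMeasure (volume.restrict (Set.Ioc (0 : ℝ) 1)) := ⟨by simp⟩
  refine ⟨Q, Qmono.measurable, hQiff,
    map_coe_eq_of_integral_floor_eq Qmono.measurable hg (fun y => ?_)
      (integrable_floor_sub hg hi) (c - 1) fun y => ?_⟩
  · simp_rw [Qfl]
    refine integrable_floor_sub measurable_id ?_ (N y)
    exact continuous_id.integrableOn_Ioc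
  · simp_rw [Qfl]
    have := integral_floor_sub_mul (ρ := fun _ => 1) continuous_const (fun _ => rfl) (by simp) (N y)
    simp only [mul_one, intervalIntegral.integral_const, sub_zero, smul_eq_mul] at this
    rw [this]
    simp only [hN, liftedCDF]
    ring

/-- If each of two lifted cumulative distribution functions is below the other one shifted by `s`,
up to a common constant, then the quantile coupling moves every point by at most `s`. -/
theorem wasserstein_map_coe_le {g₁ g₂ : Ω → ℝ} (h₁ : Measurable g₁) (h₂ : Measurable g₂)
    (i₁ : Integrable g₁ m) (i₂ : Integrable g₂ m) {s c : ℝ} (hs : 0 ≤ s)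
    (h₁₂ : ∀ y, liftedCDF m g₁ y ≤ liftedCDF m g₂ (y + s) + c)
    (h₂₁ : ∀ y, liftedCDF m g₂ y + c ≤ liftedCDF m g₁ (y + s)) :
    wasserstein (m.map fun ω => (g₁ ω : UnitAddCircle)) (m.map fun ω => (g₂ ω : UnitAddCircle))
      ≤ s := by
  obtain ⟨Q₁, mQ₁, hQ₁, e₁⟩ := exists_quantile h₁ i₁ 0
  obtain ⟨Q₂, mQ₂, hQ₂, e₂⟩ := exists_quantile h₂ i₂ c
  have : IsProbabilityMeasure (volume.restrict (Set.Ioc (0 : ℝ) 1)) := ⟨by simp⟩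
  have hc : Measurable fun x : ℝ => (x : UnitAddCircle) := AddCircle.measurable_mk'
  rw [← e₁, ← e₂]
  refine wasserstein_map_le (hc.comp mQ₁) (hc.comp mQ₂) hs (ae_of_all _ fun u => ?_)
  have a : Q₁ u ≤ Q₂ u + s := by
    rw [hQ₁, add_zero]
    exact ((hQ₂ u _).1 le_rfl).trans (h₂₁ _)
  have b : Q₂ u ≤ Q₁ u + s := by
    rw [hQ₂]
    refine le_trans ?_ (h₁₂ _)
    simpa using (hQ₁ u _).1 le_rfl
  refine (dist_coe_le _ _).trans ?_
  rw [abs_le]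
  constructor <;> linarith

end Coupling

/-! ### The transfer operator and the invariant density -/

/-- A lift `f : ℝ → ℝ` of an expanding circle map of degree `σ * D`, `σ = ±1`, recorded together
with its inverse `ψ` and with `p = |ψ'|`. The inverse branches of the circle map at `y` are
`ψ (y + j)`, `0 ≤ j < D`. The constant `θ` is the contraction rate of the inverse branches, and `κ`
bounds their distortion, that is, it is a Lipschitz constant of `log p`. -/
structure ExpandingLift where
  f : ℝ → ℝ
  ψ : ℝ → ℝ
  p : ℝ → ℝ
  D : ℕ
  σ : ℝ
  θ : ℝ
  κ : ℝ
  sign : σ = 1 ∨ σ = -1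
  two_le : 2 ≤ D
  θ_lt_one : θ < 1
  κ_nonneg : 0 ≤ κ
  p_pos : ∀ y, 0 < p y
  p_le : ∀ y, p y ≤ θ
  p_cont : Continuous p
  p_distortion : ∀ x y, p x ≤ p y * Real.exp (κ * |x - y|)
  p_periodic : Function.Periodic p D
  f_cont : Continuous f
  f_ψ : ∀ y, f (ψ y) = y
  ψ_f : ∀ x, ψ (f x) = x
  ψ_deriv : ∀ y, HasDerivAt ψ (σ * p y) y
  ψ_add : ∀ y, ψ (y + D) = ψ y + σ

/-- A `1`-periodic probability density on `ℝ` whose logarithm is `K`-Lipschitz. -/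
structure IsLogLipschitzDensity (K : ℝ) (φ : ℝ → ℝ) : Prop where
  pos : ∀ x, 0 < φ x
  periodic : Function.Periodic φ 1
  le_mul_exp : ∀ x y, φ x ≤ φ y * Real.exp (K * |x - y|)
  mass : ∫ x in (0 : ℝ)..1, φ x = 1

theorem continuous_of_le_mul_exp {K : ℝ} {φ : ℝ → ℝ}
    (h : ∀ x y, φ x ≤ φ y * Real.exp (K * |x - y|)) : Continuous φ := by
  refine continuous_iff_continuousAt.2 fun x => ?_
  have c1 : Tendsto (fun y => φ x * Real.exp (K * |y - x|)) (𝓝 x) (𝓝 (φ x)) := by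
    have : Continuous fun y => φ x * Real.exp (K * |y - x|) := by fun_prop
    simpa using this.tendsto x
  have c2 : Tendsto (fun y => φ x * Real.exp (-(K * |x - y|))) (𝓝 x) (𝓝 (φ x)) := by
    have : Continuous fun y => φ x * Real.exp (-(K * |x - y|)) := by fun_prop
    simpa using this.tendsto x
  refine tendsto_of_tendsto_of_tendsto_of_le_of_le c2 c1 (fun y => ?_) fun y => h y x
  show φ x * Real.exp (-(K * |x - y|)) ≤ φ y
  rw [Real.exp_neg, ← div_eq_mul_inv, div_le_iff₀ (Real.exp_pos _)]
  exact h x y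

namespace IsLogLipschitzDensity

variable {K : ℝ} {φ : ℝ → ℝ}

theorem continuous (h : IsLogLipschitzDensity K φ) : Continuous φ :=
  continuous_of_le_mul_exp h.le_mul_exp

theorem mono {K' : ℝ} (h : IsLogLipschitzDensity K φ) (hK : K ≤ K') :
    IsLogLipschitzDensity K' φ where
  pos := h.pos
  periodic := h.periodic
  mass := h.mass
  le_mul_exp x y := (h.le_mul_exp x y).trans <| mul_le_mul_of_nonneg_left
    (Real.exp_le_exp.2 (mul_le_mul_of_nonneg_right hK (abs_nonneg _))) (h.pos y).le

theorem mass_window (h : IsLogLipschitzDensity K φ) (x : ℝ) : ∫ y in x..x + 1, φ y = 1 := by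
  rw [h.periodic.intervalIntegral_add_eq x 0, zero_add, h.mass]

theorem le_exp (h : IsLogLipschitzDensity K φ) (hK : 0 ≤ K) (x : ℝ) : φ x ≤ Real.exp K := by
  have : ∫ _ in x..x + 1, φ x * Real.exp (-K) ≤ ∫ y in x..x + 1, φ y := by
    refine intervalIntegral.integral_mono_on (by linarith) (by simp)
      (h.continuous.intervalIntegrable _ _) fun y hy => ?_
    rw [Real.exp_neg, ← div_eq_mul_inv, div_le_iff₀ (Real.exp_pos _)]
    refine (h.le_mul_exp x y).trans (mul_le_mul_of_nonneg_left (Real.exp_le_exp.2 ?_) (h.pos y).le)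
    refine mul_le_of_le_one_right hK (abs_le.2 ⟨?_, ?_⟩) <;> linarith [hy.1, hy.2]
  rw [h.mass_window] at this
  simp only [intervalIntegral.integral_const, add_sub_cancel_left, one_smul] at this
  rwa [Real.exp_neg, ← div_eq_mul_inv, div_le_one (Real.exp_pos _)] at this

theorem exp_neg_le (h : IsLogLipschitzDensity K φ) (hK : 0 ≤ K) (x : ℝ) :
    Real.exp (-K) ≤ φ x := by
  have : ∫ y in x..x + 1, φ y ≤ ∫ _ in x..x + 1, φ x * Real.exp K := by
    refine intervalIntegral.integral_mono_on (by linarith)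
      (h.continuous.intervalIntegrable _ _) (by simp) fun y hy => ?_
    refine (h.le_mul_exp y x).trans (mul_le_mul_of_nonneg_left (Real.exp_le_exp.2 ?_) (h.pos x).le)
    refine mul_le_of_le_one_right hK (abs_le.2 ⟨?_, ?_⟩) <;> linarith [hy.1, hy.2]
  rw [h.mass_window] at this
  simp only [intervalIntegral.integral_const, add_sub_cancel_left, one_smul] at this
  rwa [Real.exp_neg, inv_eq_one_div, div_le_iff₀ (Real.exp_pos _)]

theorem const_one (hK : 0 ≤ K) : IsLogLipschitzDensity K fun _ => 1 where
  pos _ := one_pos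
  periodic _ := rfl
  mass := by simp
  le_mul_exp x y := by
    rw [one_mul]; exact Real.one_le_exp (mul_nonneg hK (abs_nonneg _))

/-- A small constant can be subtracted from a density in the smaller cone without leaving the
larger cone. -/
theorem exists_eq_add (h : IsLogLipschitzDensity (K - 1) φ) (hK : 1 ≤ K) :
    ∃ χ, IsLogLipschitzDensity K χ ∧
      φ = (Real.exp (-K) / K) • (fun _ => (1 : ℝ)) + (1 - Real.exp (-K) / K) • χ := by
  set δ := Real.exp (-K) / K with hδ
  have hK0 : 0 < K := by linarith
  have hδ1 : δ < 1 := by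
    rw [hδ, div_lt_one hK0]
    exact (Real.exp_lt_one_iff.2 (by linarith)).trans_le hK
  have hφ : ∀ x, Real.exp (-K) < φ x := fun x =>
    (Real.exp_lt_exp.2 (by linarith)).trans_le (h.exp_neg_le (by linarith) x)
  have hδφ : ∀ x, δ < φ x := fun x =>
    (div_le_self (Real.exp_pos _).le hK).trans_lt (hφ x)
  have h1δ : 0 < 1 - δ := by linarith
  refine ⟨fun x => (φ x - δ) / (1 - δ), ⟨fun x => ?_, fun x => ?_, fun x y => ?_, ?_⟩, ?_⟩
  · exact div_pos (by linarith [hδφ x]) h1δ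
  · simp only [h.periodic x]
  · rw [div_mul_eq_mul_div]
    refine div_le_div_of_nonneg_right ?_ h1δ.le
    set d := |x - y| with hd
    have hd0 : 0 ≤ d := abs_nonneg _
    have hle : φ x ≤ φ y * Real.exp ((K - 1) * d) := h.le_mul_exp x y
    -- Bernoulli's inequality `1 - e^{-Kd} ≤ K (1 - e^{-d})`
    have hB : Real.exp (K * d) - 1 ≤ K * (Real.exp (K * d) - Real.exp ((K - 1) * d)) := by
      have hb := one_add_mul_self_le_rpow_one_add (s := Real.exp (-d) - 1)
        (by linarith [Real.exp_pos (-d)]) hK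
      rw [add_sub_cancel, ← Real.exp_mul] at hb
      have hb' := mul_le_mul_of_nonneg_left hb (Real.exp_pos (K * d)).le
      rw [← Real.exp_add] at hb'
      have e1 : K * d + -d * K = 0 := by ring
      have e2 : Real.exp ((K - 1) * d) = Real.exp (K * d) * Real.exp (-d) := by
        rw [← Real.exp_add]; ring_nf
      rw [e1, Real.exp_zero] at hb'
      rw [e2]
      nlinarith
    have hpos : 0 ≤ Real.exp (K * d) - Real.exp ((K - 1) * d) :=
      sub_nonneg.2 (Real.exp_le_exp.2 (mul_le_mul_of_nonneg_right (by linarith) hd0))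
    have : δ * (Real.exp (K * d) - 1) ≤ φ y * (Real.exp (K * d) - Real.exp ((K - 1) * d)) := by
      calc δ * (Real.exp (K * d) - 1)
          ≤ δ * (K * (Real.exp (K * d) - Real.exp ((K - 1) * d))) :=
            mul_le_mul_of_nonneg_left hB (by positivity)
        _ = Real.exp (-K) * (Real.exp (K * d) - Real.exp ((K - 1) * d)) := by
            rw [hδ]; field_simp
        _ ≤ _ := mul_le_mul_of_nonneg_right (hφ y).le hpos
    linarith
  · rw [intervalIntegral.integral_div, intervalIntegral.integral_sub
      (h.continuous.intervalIntegrable _ _) (by simp), h.mass]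
    simp [h1δ.ne']
  · ext x
    simp only [Pi.add_apply, Pi.smul_apply, smul_eq_mul]
    field_simp
    ring

end IsLogLipschitzDensity

namespace ExpandingLift

variable (S : ExpandingLift)

theorem θ_pos : 0 < S.θ := (S.p_pos 0).trans_le (S.p_le 0)

theorem abs_σ : |S.σ| = 1 := by
  rcases S.sign with h | h <;> simp [h]

theorem σ_mul_σ : S.σ * S.σ = 1 := by
  rcases S.sign with h | h <;> simp [h]

theorem ψ_cont : Continuous S.ψ :=
  continuous_iff_continuousAt.2 fun y => (S.ψ_deriv y).continuousAt

theorem abs_ψ_sub_le (x y : ℝ) : |S.ψ x - S.ψ y| ≤ S.θ * |x - y| := by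
  refine Convex.norm_image_sub_le_of_norm_hasDerivWithin_le (s := Set.univ)
    (fun z _ => (S.ψ_deriv z).hasDerivWithinAt) (fun z _ => ?_) convex_univ trivial trivial
  rw [Real.norm_eq_abs, abs_mul, S.abs_σ, one_mul, abs_of_pos (S.p_pos z)]
  exact S.p_le z

theorem periodic_comp_ψ {φ : ℝ → ℝ} (hφ : Function.Periodic φ 1) :
    Function.Periodic (fun y => φ (S.ψ y)) S.D := by
  intro y
  simp only [S.ψ_add]
  rcases S.sign with h | h
  · rw [h]; exact hφ _
  · rw [h, ← sub_eq_add_neg]; exact hφ.sub_eq _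

/-- The degree is `σ * D`. -/
theorem f_add_int (x : ℝ) (k : ℤ) : S.f (x + k) = S.f x + S.σ * S.D * k := by
  have h1 : ∀ x, S.f (x + S.σ) = S.f x + S.D := fun x => by
    conv_lhs => rw [← S.ψ_f x, ← S.ψ_add, S.f_ψ]
  have h2 : ∀ x, S.f (x + 1) = S.f x + S.σ * S.D := fun x => by
    rcases S.sign with h | h
    · have := h1 x; rw [h] at this ⊢; linarith
    · have := h1 (x + 1); rw [h] at this ⊢
      rw [add_neg_cancel_right] at this; linarith
  induction k with
  | zero => simp
  | succ k ih =>
    push_cast at ih ⊢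
    rw [← add_assoc, h2, ih]; ring
  | pred k ih =>
    have := h2 (x + (-(k : ℝ) - 1))
    push_cast at ih ⊢
    rw [show x + (-(k : ℝ) - 1) + 1 = x + -k by ring, ih] at this
    linarith

theorem periodic_comp_f {φ : ℝ → ℝ} (hφ : Function.Periodic φ 1) :
    Function.Periodic (fun x => φ (S.f x)) 1 := by
  intro x
  have := S.f_add_int x 1
  rw [Int.cast_one] at this
  simp only [this, mul_one]
  rcases S.sign with h | h
  · rw [h, one_mul]
    simpa using hφ.nat_mul S.D (S.f x)
  · rw [h, neg_one_mul, ← sub_eq_add_neg]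
    simpa using hφ.sub_nat_mul_eq S.D (x := S.f x)

/-- The sum of a `D`-periodic function over `D` consecutive unit translates is `1`-periodic. -/
theorem periodic_sum {F : ℝ → ℝ} (hF : Function.Periodic F S.D) :
    Function.Periodic (fun y => ∑ j ∈ Finset.range S.D, F (y + j)) 1 := by
  intro y
  have h1 := Finset.sum_range_succ (fun j : ℕ => F (y + j)) S.D
  have h2 := Finset.sum_range_succ' (fun j : ℕ => F (y + j)) S.D
  rw [h1] at h2
  simp only [Nat.cast_zero, add_zero, hF y, Nat.cast_succ] at h2
  rw [add_right_cancel_iff] at h2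
  simp only [h2]
  exact Finset.sum_congr rfl fun j _ => by rw [add_right_comm, add_assoc]

/-- The transfer operator on densities: if `φ` is the density of a measure on the circle, then
`transfer φ` is the density of its push-forward. It is defined on all functions `ℝ → ℝ`, and
preserves the `1`-periodic ones. -/
noncomputable def transfer : (ℝ → ℝ) →ₗ[ℝ] (ℝ → ℝ) where
  toFun φ y := ∑ j ∈ Finset.range S.D, S.p (y + j) * φ (S.ψ (y + j))
  map_add' φ χ := by
    ext y; simp only [Pi.add_apply, mul_add, Finset.sum_add_distrib]
  map_smul' c φ := by
    ext y
    simp only [Pi.smul_apply, smul_eq_mul, RingHom.id_apply, Finset.mul_sum]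
    exact Finset.sum_congr rfl fun j _ => by ring

theorem transfer_apply (φ : ℝ → ℝ) (y : ℝ) :
    S.transfer φ y = ∑ j ∈ Finset.range S.D, S.p (y + j) * φ (S.ψ (y + j)) := rfl

theorem transfer_continuous {φ : ℝ → ℝ} (hφ : Continuous φ) : Continuous (S.transfer φ) := by
  have h1 := S.p_cont
  have h2 := S.ψ_cont
  show Continuous fun y => ∑ j ∈ Finset.range S.D, S.p (y + j) * φ (S.ψ (y + j))
  fun_prop

theorem transfer_periodic {φ : ℝ → ℝ} (hφ : Function.Periodic φ 1) :
    Function.Periodic (S.transfer φ) 1 :=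
  S.periodic_sum (F := fun y => S.p y * φ (S.ψ y)) (S.p_periodic.mul (S.periodic_comp_ψ hφ))

/-- The transfer operator preserves mass: the inverse branches tile a period. -/
theorem integral_transfer {φ : ℝ → ℝ} (hφ : Continuous φ) (hper : Function.Periodic φ 1) :
    ∫ y in (0 : ℝ)..1, S.transfer φ y = ∫ x in (0 : ℝ)..1, φ x := by
  have h1 := S.p_cont
  have h2 := S.ψ_cont
  set F : ℝ → ℝ := fun y => S.p y * φ (S.ψ y) with hF
  have hFc : Continuous F := by fun_prop
  have e1 : ∫ y in (0 : ℝ)..1, S.transfer φ y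
      = ∑ j ∈ Finset.range S.D, ∫ y in (j : ℝ)..((j + 1 : ℕ) : ℝ), F y := by
    have : ∀ y, S.transfer φ y = ∑ j ∈ Finset.range S.D, F (y + j) := fun y => rfl
    simp_rw [this]
    rw [intervalIntegral.integral_finsetSum fun j _ =>
      Continuous.intervalIntegrable (by fun_prop) _ _]
    refine Finset.sum_congr rfl fun j _ => ?_
    rw [intervalIntegral.integral_comp_add_right]
    push_cast
    rw [zero_add, add_comm]
  have e2 : S.σ * ∫ y in (0 : ℝ)..(S.D : ℝ), F y = ∫ x in S.ψ 0..S.ψ 0 + S.σ, φ x := by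
    rw [← intervalIntegral.integral_const_mul]
    have := intervalIntegral.integral_comp_mul_deriv (a := 0) (b := (S.D : ℝ)) (f := S.ψ)
      (f' := fun y => S.σ * S.p y) (g := φ) (fun y _ => S.ψ_deriv y) (by fun_prop) hφ
    have h3 := S.ψ_add 0
    rw [zero_add] at h3
    rw [h3] at this
    rw [← this]
    refine intervalIntegral.integral_congr fun y _ => ?_
    simp only [hF, Function.comp]
    ring
  rw [e1, intervalIntegral.sum_integral_adjacent_intervals
    fun k _ => hFc.intervalIntegrable _ _, Nat.cast_zero]
  have e3 : ∫ y in (0 : ℝ)..(S.D : ℝ), F y = S.σ * ∫ x in S.ψ 0..S.ψ 0 + S.σ, φ x := by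
    rw [← e2, ← mul_assoc, S.σ_mul_σ, one_mul]
  rw [e3]
  rcases S.sign with h | h
  · rw [h, one_mul, hper.intervalIntegral_add_eq (S.ψ 0) 0, zero_add]
  · rw [h, intervalIntegral.integral_symm, mul_neg, neg_one_mul, neg_neg]
    have := hper.intervalIntegral_add_eq (S.ψ 0 + -1) 0
    rw [zero_add] at this
    rw [← this]
    congr 1
    ring

theorem transfer_comp_f_mul {h : ℝ → ℝ} (hper : Function.Periodic h 1) (φ : ℝ → ℝ) :
    S.transfer (fun x => h (S.f x) * φ x) = fun y => h y * S.transfer φ y := by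
  ext y
  simp only [transfer_apply, S.f_ψ, Finset.mul_sum]
  refine Finset.sum_congr rfl fun j _ => ?_
  have : h (y + j) = h y := by simpa using hper.nat_mul j y
  rw [this]
  ring

/-- Duality between the transfer operator and composition with the map. -/
theorem integral_comp_f_mul {h φ : ℝ → ℝ} (hc : Continuous h) (hper : Function.Periodic h 1)
    (φc : Continuous φ) (φper : Function.Periodic φ 1) :
    ∫ x in (0 : ℝ)..1, h (S.f x) * φ x = ∫ y in (0 : ℝ)..1, h y * S.transfer φ y := by
  have := S.f_cont
  rw [← S.integral_transfer (φ := fun x => h (S.f x) * φ x) (by fun_prop)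
    ((S.periodic_comp_f hper).mul φper), S.transfer_comp_f_mul hper]

/-- The contraction of the inverse branches reduces the log-Lipschitz constant by the factor `θ`,
and their distortion adds `κ`. -/
theorem transfer_logLipschitz {K K' : ℝ} {φ : ℝ → ℝ} (h : IsLogLipschitzDensity K φ) (hK : 0 ≤ K)
    (hK' : S.κ + S.θ * K ≤ K') : IsLogLipschitzDensity K' (S.transfer φ) where
  pos y := Finset.sum_pos (fun j _ => mul_pos (S.p_pos _) (h.pos _))
    (Finset.nonempty_range_iff.2 (by have := S.two_le; omega))
  periodic := S.transfer_periodic h.periodic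
  mass := by rw [S.integral_transfer h.continuous h.periodic, h.mass]
  le_mul_exp x y := by
    rw [transfer_apply, transfer_apply, Finset.sum_mul]
    refine Finset.sum_le_sum fun j _ => ?_
    have h1 := S.p_distortion (x + j) (y + j)
    have h2 := h.le_mul_exp (S.ψ (x + j)) (S.ψ (y + j))
    have h3 := S.abs_ψ_sub_le (x + j) (y + j)
    rw [add_sub_add_right_eq_sub] at h1 h3
    calc S.p (x + j) * φ (S.ψ (x + j))
        ≤ (S.p (y + j) * Real.exp (S.κ * |x - y|)) *
          (φ (S.ψ (y + j)) * Real.exp (K * (S.θ * |x - y|))) := by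
          refine mul_le_mul h1 (h2.trans ?_) (h.pos _).le
            (mul_pos (S.p_pos _) (Real.exp_pos _)).le
          refine mul_le_mul_of_nonneg_left (Real.exp_le_exp.2 ?_) (h.pos _).le
          exact mul_le_mul_of_nonneg_left h3 hK
      _ = S.p (y + j) * φ (S.ψ (y + j)) * Real.exp ((S.κ + S.θ * K) * |x - y|) := by
          rw [show (S.κ + S.θ * K) * |x - y| = S.κ * |x - y| + K * (S.θ * |x - y|) by ring,
            Real.exp_add]
          ring
      _ ≤ _ := by
          refine mul_le_mul_of_nonneg_left (Real.exp_le_exp.2 ?_)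
            (mul_pos (S.p_pos _) (h.pos _)).le
          exact mul_le_mul_of_nonneg_right hK' (abs_nonneg _)

/-- For `K ≥ logLip` the transfer operator maps the cone of `K`-log-Lipschitz densities into the
cone of `(K - 1)`-log-Lipschitz densities. -/
noncomputable def logLip : ℝ := (S.κ + 1) / (1 - S.θ)

theorem one_le_logLip : 1 ≤ S.logLip := by
  have h1 := S.θ_lt_one
  have h2 := S.θ_pos
  have h3 := S.κ_nonneg
  rw [logLip, le_div_iff₀ (by linarith)]
  linarith

theorem transfer_logLipschitz_sub_one {K : ℝ} (hK : S.logLip ≤ K) {φ : ℝ → ℝ}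
    (h : IsLogLipschitzDensity K φ) : IsLogLipschitzDensity (K - 1) (S.transfer φ) := by
  refine S.transfer_logLipschitz h (by linarith [S.one_le_logLip]) ?_
  have h1 := S.θ_lt_one
  rw [logLip, div_le_iff₀ (by linarith)] at hK
  linarith

theorem transfer_pow_logLipschitz {K : ℝ} (hK : S.logLip ≤ K) {φ : ℝ → ℝ}
    (h : IsLogLipschitzDensity K φ) (n : ℕ) : IsLogLipschitzDensity K ((S.transfer ^ n) φ) := by
  induction n with
  | zero => simpa using h
  | succ n ih =>
    rw [pow_succ', Module.End.mul_apply]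
    exact (S.transfer_logLipschitz_sub_one hK ih).mono (by linarith)

/-- Exponential loss of memory: at every step a fixed proportion of the two densities becomes
equal, the remainders staying in the cone. -/
theorem abs_transfer_pow_sub_le {K : ℝ} (hK : S.logLip ≤ K) (n : ℕ) :
    ∀ {φ χ : ℝ → ℝ}, IsLogLipschitzDensity K φ → IsLogLipschitzDensity K χ → ∀ x,
      |(S.transfer ^ n) φ x - (S.transfer ^ n) χ x| ≤
        Real.exp K * (1 - Real.exp (-K) / K) ^ n := by
  have hK1 : 1 ≤ K := S.one_le_logLip.trans hK
  have hδ : Real.exp (-K) / K ≤ 1 := by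
    rw [div_le_one (by linarith)]
    exact (Real.exp_lt_one_iff.2 (by linarith)).le.trans hK1
  induction n with
  | zero =>
    intro φ χ hφ hχ x
    simp only [pow_zero, Module.End.one_apply, mul_one]
    have h1 := hφ.le_exp (by linarith) x
    have h2 := hχ.le_exp (by linarith) x
    rw [abs_le]
    constructor <;> linarith [hφ.pos x, hχ.pos x]
  | succ n ih =>
    intro φ χ hφ hχ x
    obtain ⟨φ', hφ', e1⟩ := (S.transfer_logLipschitz_sub_one hK hφ).exists_eq_add hK1
    obtain ⟨χ', hχ', e2⟩ := (S.transfer_logLipschitz_sub_one hK hχ).exists_eq_add hK1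
    rw [pow_succ, Module.End.mul_apply, Module.End.mul_apply, e1, e2]
    simp only [map_add, map_smul, Pi.add_apply, Pi.smul_apply, smul_eq_mul,
      add_sub_add_left_eq_sub, ← mul_sub]
    rw [abs_mul, abs_of_nonneg (sub_nonneg.2 hδ), pow_succ, ← mul_assoc, mul_comm]
    exact mul_le_mul_of_nonneg_right (ih hφ' hχ' x) (sub_nonneg.2 hδ)

/-- The iterates of the transfer operator on the uniform density converge to an invariant
density. -/
theorem exists_invariant_density :
    ∃ ρ, IsLogLipschitzDensity S.logLip ρ ∧ S.transfer ρ = ρ := by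
  set K := S.logLip with hKdef
  have hK1 : 1 ≤ K := S.one_le_logLip
  have hK0 : 0 ≤ K := by linarith
  set r := 1 - Real.exp (-K) / K with hr
  have hr1 : r < 1 := by
    have : 0 < Real.exp (-K) / K := div_pos (Real.exp_pos _) (by linarith)
    linarith
  set a : ℕ → ℝ → ℝ := fun n => (S.transfer ^ n) (fun _ => 1) with ha
  have h1 : IsLogLipschitzDensity K (fun _ => 1) := IsLogLipschitzDensity.const_one hK0
  have haK : ∀ n, IsLogLipschitzDensity K (a n) := S.transfer_pow_logLipschitz le_rfl h1
  have hsucc : ∀ n, S.transfer (a n) = a (n + 1) := fun n => by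
    simp only [ha]; rw [pow_succ', Module.End.mul_apply]
  have hdist : ∀ x n, dist (a n x) (a (n + 1) x) ≤ Real.exp K * r ^ n := fun x n => by
    have := S.abs_transfer_pow_sub_le le_rfl n h1 (haK 1) x
    rw [Real.dist_eq]
    convert this using 3
    simp only [ha]
    rw [pow_one, pow_succ, Module.End.mul_apply]
  have hlim : ∀ x, ∃ l, Tendsto (fun n => a n x) atTop (𝓝 l) := fun x =>
    cauchySeq_tendsto_of_complete (cauchySeq_of_le_geometric r _ hr1 (hdist x))
  choose ρ hρ using hlim
  refine ⟨ρ, ⟨fun x => ?_, fun x => ?_, fun x y => ?_, ?_⟩, ?_⟩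
  · exact (Real.exp_pos _).trans_le
      (ge_of_tendsto' (hρ x) fun n => (haK n).exp_neg_le hK0 x)
  · refine tendsto_nhds_unique (hρ (x + 1)) ?_
    simp_rw [(haK _).periodic x]
    exact hρ x
  · exact le_of_tendsto_of_tendsto' (hρ x) ((hρ y).mul_const _) fun n => (haK n).le_mul_exp x y
  · have : Tendsto (fun n => ∫ x in (0 : ℝ)..1, a n x) atTop (𝓝 (∫ x in (0 : ℝ)..1, ρ x)) := by
      refine intervalIntegral.tendsto_integral_filter_of_dominated_convergence
        (fun _ => Real.exp K) ?_ ?_ (by simp) (ae_of_all _ fun x _ => hρ x)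
      · exact Eventually.of_forall fun n => (haK n).continuous.aestronglyMeasurable
      · refine Eventually.of_forall fun n => ae_of_all _ fun x _ => ?_
        rw [Real.norm_eq_abs, abs_of_pos ((haK n).pos x)]
        exact (haK n).le_exp hK0 x
    simp_rw [(haK _).mass] at this
    exact tendsto_nhds_unique this tendsto_const_nhds
  · ext y
    have t1 : Tendsto (fun n => S.transfer (a n) y) atTop (𝓝 (S.transfer ρ y)) := by
      simp only [transfer_apply]
      exact tendsto_finsetSum _ fun j _ => (hρ _).const_mul _
    simp_rw [hsucc] at t1
    exact tendsto_nhds_unique t1 ((tendsto_add_atTop_iff_nat 1).2 (hρ y))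

end ExpandingLift

/-! ### Uniqueness of the absolutely continuous invariant measure -/

section Periodic

theorem measurable_coe : Measurable fun x : ℝ => (x : UnitAddCircle) := AddCircle.measurable_mk'

theorem continuous_coe : Continuous fun x : ℝ => (x : UnitAddCircle) := AddCircle.continuous_mk' 1

theorem periodic_comp_coe {α : Type*} (h : UnitAddCircle → α) :
    Function.Periodic (fun x : ℝ => h (x : UnitAddCircle)) 1 := fun x => by
  have : ((x + 1 : ℝ) : UnitAddCircle) = x := AddCircle.coe_add_period 1 x
  simp only [this]

theorem continuous_of_comp_coe {α : Type*} [TopologicalSpace α] {h : UnitAddCircle → α}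
    (hc : Continuous fun x : ℝ => h (x : UnitAddCircle)) : Continuous h :=
  (QuotientAddGroup.isQuotientMap_mk _).continuous_iff.2 hc

variable {φ : ℝ → ℝ}

theorem Function.Periodic.continuous_lift (hper : Function.Periodic φ 1) (hφ : Continuous φ) :
    Continuous (hper.lift : UnitAddCircle → ℝ) :=
  continuous_of_comp_coe hφ

theorem Function.Periodic.exists_abs_le (hper : Function.Periodic φ 1) (hφ : Continuous φ) :
    ∃ B, 0 < B ∧ ∀ x, |φ x| ≤ B := by
  obtain ⟨B, hB⟩ := isCompact_univ.exists_bound_of_continuousOn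
    (hper.continuous_lift hφ).continuousOn
  refine ⟨max B 1, by positivity, fun x => (hB x trivial).trans (le_max_left _ _)⟩

theorem Function.Periodic.exists_modulus (hper : Function.Periodic φ 1) (hφ : Continuous φ)
    {ε : ℝ} (hε : 0 < ε) : ∃ δ > 0, ∀ x y, |x - y| < δ → |φ x - φ y| < ε := by
  obtain ⟨δ, hδ, h⟩ := Metric.uniformContinuous_iff.1
    (CompactSpace.uniformContinuous_of_continuous (hper.continuous_lift hφ)) ε hε
  exact ⟨δ, hδ, fun x y hxy => h ((dist_coe_le x y).trans_lt hxy)⟩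

theorem continuous_of_abs_sub_le {M : ℝ} (hM : 0 ≤ M) (h : ∀ x y, |φ x - φ y| ≤ M * |x - y|) :
    Continuous φ :=
  (LipschitzWith.of_dist_le_mul (K := ⟨M, hM⟩) h).continuous

/-- Steklov averages: a continuous periodic function is a uniform limit of Lipschitz ones. -/
theorem Function.Periodic.exists_lipschitz_approx (hper : Function.Periodic φ 1)
    (hφ : Continuous φ) {ε : ℝ} (hε : 0 < ε) :
    ∃ χ : ℝ → ℝ, Function.Periodic χ 1 ∧ (∃ M, 0 ≤ M ∧ ∀ x y, |χ x - χ y| ≤ M * |x - y|) ∧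
      ∀ x, |φ x - χ x| ≤ ε := by
  obtain ⟨B, hB0, hB⟩ := hper.exists_abs_le hφ
  obtain ⟨δ, hδ, hmod⟩ := hper.exists_modulus hφ hε
  have hint : ∀ a b, IntervalIntegrable φ volume a b := fun a b => hφ.intervalIntegrable a b
  set s := δ / 2 with hs
  have hs0 : 0 < s := half_pos hδ
  refine ⟨fun x => s⁻¹ * ∫ y in x..x + s, φ y, fun x => ?_, ⟨s⁻¹ * (2 * B), by positivity,
    fun x y => ?_⟩, fun x => ?_⟩
  · have := intervalIntegral.integral_comp_add_right (a := x) (b := x + s) φ 1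
    simp only [hper _] at this
    simp only [this, add_right_comm]
  · have hbd : ∀ a b, |∫ z in a..b, φ z| ≤ B * |a - b| := fun a b => by
      rw [abs_sub_comm]
      exact intervalIntegral.norm_integral_le_of_norm_le_const (f := φ) fun z _ => hB z
    have e : (∫ z in x..x + s, φ z) - ∫ z in y..y + s, φ z
        = (∫ z in x..y, φ z) - ∫ z in x + s..y + s, φ z := by
      have h1 := intervalIntegral.integral_add_adjacent_intervals (hint x y) (hint y (y + s))
      have h2 := intervalIntegral.integral_add_adjacent_intervals (hint x (x + s))
        (hint (x + s) (y + s))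
      linarith
    rw [← mul_sub, abs_mul, abs_of_pos (inv_pos.2 hs0), mul_assoc, e]
    refine mul_le_mul_of_nonneg_left ?_ (inv_pos.2 hs0).le
    have h1 := hbd x y
    have h2 := hbd (x + s) (y + s)
    rw [add_sub_add_right_eq_sub] at h2
    have h3 := abs_sub (∫ z in x..y, φ z) (∫ z in x + s..y + s, φ z)
    linarith
  · have e : φ x - s⁻¹ * ∫ y in x..x + s, φ y = s⁻¹ * ∫ y in x..x + s, (φ x - φ y) := by
      rw [intervalIntegral.integral_sub (by simp) (hint _ _)]
      simp only [intervalIntegral.integral_const, add_sub_cancel_left, smul_eq_mul]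
      field_simp
    rw [e, abs_mul, abs_of_pos (inv_pos.2 hs0), inv_mul_le_iff₀ hs0]
    have := intervalIntegral.norm_integral_le_of_norm_le_const (a := x) (b := x + s) (C := ε)
      (f := fun y => φ x - φ y) fun y hy => by
        rw [Set.uIoc_of_le (by linarith)] at hy
        refine (hmod x y ?_).le
        rw [abs_lt]
        constructor <;> linarith [hy.1, hy.2]
    rwa [add_sub_cancel_left, abs_of_pos hs0, Real.norm_eq_abs, mul_comm] at this

end Periodic

/-- The measure on the fundamental domain `(0, 1]` with density `ρ`. -/
noncomputable def densityMeasure (ρ : ℝ → ℝ) : Measure ℝ :=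
  (volume.restrict (Set.Ioc 0 1)).withDensity fun x => ENNReal.ofReal (ρ x)

namespace IsLogLipschitzDensity

variable {K : ℝ} {ρ : ℝ → ℝ}

theorem integral_densityMeasure (h : IsLogLipschitzDensity K ρ) (g : ℝ → ℝ) :
    ∫ x, g x ∂(densityMeasure ρ) = ∫ x in Set.Ioc (0 : ℝ) 1, g x * ρ x := by
  have hm : Measurable fun x => ENNReal.ofReal (ρ x) := h.continuous.measurable.ennreal_ofReal
  rw [densityMeasure, integral_withDensity_eq_integral_toReal_smul hm
    (ae_of_all _ fun x => ENNReal.ofReal_lt_top)]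
  refine integral_congr_ae (ae_of_all _ fun x => ?_)
  simp only [ENNReal.toReal_ofReal (h.pos x).le, smul_eq_mul, mul_comm]

theorem intervalIntegral_eq_integral_densityMeasure (h : IsLogLipschitzDensity K ρ) (g : ℝ → ℝ) :
    ∫ x in (0 : ℝ)..1, g x * ρ x = ∫ x, g x ∂(densityMeasure ρ) := by
  rw [h.integral_densityMeasure, intervalIntegral.integral_of_le zero_le_one]

theorem isProbabilityMeasure (h : IsLogLipschitzDensity K ρ) :
    IsProbabilityMeasure (densityMeasure ρ) := by
  constructor
  rw [densityMeasure, withDensity_apply _ MeasurableSet.univ, Measure.restrict_univ,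
    ← ofReal_integral_eq_lintegral_ofReal h.continuous.integrableOn_Ioc
      (ae_of_all _ fun x => (h.pos x).le),
    ← intervalIntegral.integral_of_le zero_le_one, h.mass, ENNReal.ofReal_one]

theorem integrable_densityMeasure (h : IsLogLipschitzDensity K ρ) {g : ℝ → ℝ}
    (hg : Continuous g) : Integrable g (densityMeasure ρ) := by
  have hm : Measurable fun x => ENNReal.ofReal (ρ x) := h.continuous.measurable.ennreal_ofReal
  rw [densityMeasure, integrable_withDensity_iff hm (ae_of_all _ fun x => ENNReal.ofReal_lt_top)]
  simp_rw [ENNReal.toReal_ofReal (h.pos _).le]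
  exact (hg.mul h.continuous).integrableOn_Ioc

end IsLogLipschitzDensity

/-- The probability measure on the circle with the given density. -/
noncomputable def circleMeasure (ρ : ℝ → ℝ) : Measure UnitAddCircle :=
  (densityMeasure ρ).map fun x : ℝ => (x : UnitAddCircle)

theorem circleMeasure_absolutelyContinuous (ρ : ℝ → ℝ) :
    circleMeasure ρ ≪ (volume : Measure UnitAddCircle) := by
  have h1 : densityMeasure ρ ≪ volume.restrict (Set.Ioc (0 : ℝ) (0 + 1)) := by
    rw [zero_add]; exact withDensity_absolutelyContinuous _ _
  have h2 := h1.map measurable_coe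
  rwa [(UnitAddCircle.measurePreserving_mk 0).map_eq] at h2

theorem IsLogLipschitzDensity.integral_circleMeasure {K : ℝ} {ρ : ℝ → ℝ}
    (hρ : IsLogLipschitzDensity K ρ) {h : UnitAddCircle → ℝ} (hc : Continuous h) :
    ∫ z, h z ∂(circleMeasure ρ) = ∫ x in (0 : ℝ)..1, h x * ρ x := by
  rw [circleMeasure, integral_map measurable_coe.aemeasurable hc.aestronglyMeasurable,
    hρ.intervalIntegral_eq_integral_densityMeasure]

theorem IsLogLipschitzDensity.isProbabilityMeasure_circleMeasure {K : ℝ} {ρ : ℝ → ℝ}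
    (hρ : IsLogLipschitzDensity K ρ) : IsProbabilityMeasure (circleMeasure ρ) :=
  have := hρ.isProbabilityMeasure
  Measure.isProbabilityMeasure_map measurable_coe.aemeasurable

namespace ExpandingLift

variable (S : ExpandingLift)

theorem periodic_comp_iterate_f {φ : ℝ → ℝ} (hφ : Function.Periodic φ 1) (n : ℕ) :
    Function.Periodic (fun x => φ (S.f^[n] x)) 1 := by
  induction n with
  | zero => simpa using hφ
  | succ n ih =>
    simp_rw [Function.iterate_succ_apply]
    exact S.periodic_comp_f ih

theorem integral_comp_iterate_f_mul {h : ℝ → ℝ} (hc : Continuous h) (hper : Function.Periodic h 1)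
    (n : ℕ) : ∀ {φ : ℝ → ℝ}, Continuous φ → Function.Periodic φ 1 →
      ∫ x in (0 : ℝ)..1, h (S.f^[n] x) * φ x =
        ∫ y in (0 : ℝ)..1, h y * (S.transfer ^ n) φ y := by
  induction n with
  | zero => intro φ _ _; simp
  | succ n ih =>
    intro φ φc φper
    simp_rw [Function.iterate_succ_apply, pow_succ, Module.End.mul_apply]
    rw [← ih (S.transfer_continuous φc) (S.transfer_periodic φper)]
    exact S.integral_comp_f_mul (h := fun x => h (S.f^[n] x))
      (hc.comp (S.f_cont.iterate n)) (S.periodic_comp_iterate_f hper n) φc φper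

variable {S} {ρ : ℝ → ℝ}

theorem transfer_pow_eq (hS : S.transfer ρ = ρ) (n : ℕ) : (S.transfer ^ n) ρ = ρ := by
  induction n with
  | zero => simp
  | succ n ih => rw [pow_succ, Module.End.mul_apply, hS, ih]

/-- Mixing for densities in the cone. -/
theorem tendsto_integral_comp_iterate_of_logLipschitz (hρ : IsLogLipschitzDensity S.logLip ρ)
    (hS : S.transfer ρ = ρ) {h : ℝ → ℝ} (hc : Continuous h) (hper : Function.Periodic h 1)
    {K : ℝ} (hK : S.logLip ≤ K) {φ : ℝ → ℝ} (hφ : IsLogLipschitzDensity K φ) :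
    Tendsto (fun n => ∫ x in (0 : ℝ)..1, h (S.f^[n] x) * φ x) atTop
      (𝓝 (∫ x in (0 : ℝ)..1, h x * ρ x)) := by
  have hK1 : 1 ≤ K := S.one_le_logLip.trans hK
  have hr0 : 0 ≤ 1 - Real.exp (-K) / K := by
    rw [sub_nonneg, div_le_one (by linarith)]
    exact (Real.exp_lt_one_iff.2 (by linarith)).le.trans hK1
  have hr1 : 1 - Real.exp (-K) / K < 1 := by
    have : 0 < Real.exp (-K) / K := div_pos (Real.exp_pos _) (by linarith)
    linarith
  simp_rw [fun n => S.integral_comp_iterate_f_mul hc hper n hφ.continuous hφ.periodic]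
  refine intervalIntegral.tendsto_integral_filter_of_dominated_convergence
    (fun x => |h x| * Real.exp K) ?_ ?_ ?_ ?_
  · exact Eventually.of_forall fun n =>
      (hc.mul (S.transfer_pow_logLipschitz hK hφ n).continuous).aestronglyMeasurable
  · refine Eventually.of_forall fun n => ae_of_all _ fun x _ => ?_
    have hn := S.transfer_pow_logLipschitz hK hφ n
    rw [norm_mul, Real.norm_eq_abs, Real.norm_eq_abs, abs_of_pos (hn.pos x)]
    exact mul_le_mul_of_nonneg_left (hn.le_exp (by linarith) x) (abs_nonneg _)
  · exact (hc.abs.mul continuous_const).intervalIntegrable _ _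
  · refine ae_of_all _ fun x _ => Tendsto.const_mul _ ?_
    rw [tendsto_iff_dist_tendsto_zero]
    refine squeeze_zero (fun n => dist_nonneg) (fun n => ?_)
      (g := fun n => Real.exp K * (1 - Real.exp (-K) / K) ^ n) ?_
    · have := S.abs_transfer_pow_sub_le hK n hφ (hρ.mono hK) x
      rwa [transfer_pow_eq hS] at this
    · simpa using (tendsto_pow_atTop_nhds_zero_of_lt_one hr0 hr1).const_mul (Real.exp K)

/-- Mixing for Lipschitz observables, which become log-Lipschitz after adding a constant. -/
theorem tendsto_integral_comp_iterate_of_lipschitz (hρ : IsLogLipschitzDensity S.logLip ρ)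
    (hS : S.transfer ρ = ρ) {h : ℝ → ℝ} (hc : Continuous h) (hper : Function.Periodic h 1)
    {φ : ℝ → ℝ} (φc : Continuous φ) (φper : Function.Periodic φ 1) {M : ℝ} (hM : 0 ≤ M)
    (hφ : ∀ x y, |φ x - φ y| ≤ M * |x - y|) :
    Tendsto (fun n => ∫ x in (0 : ℝ)..1, h (S.f^[n] x) * φ x) atTop
      (𝓝 ((∫ x in (0 : ℝ)..1, φ x) * ∫ x in (0 : ℝ)..1, h x * ρ x)) := by
  obtain ⟨B, -, hB⟩ := φper.exists_abs_le φc
  set K := max M S.logLip with hKdef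
  have hK0 : 0 ≤ K := hM.trans (le_max_left _ _)
  set c := B + 1 with hcdef
  have hpos : ∀ x, 1 ≤ φ x + c := fun x => by linarith [neg_abs_le (φ x), hB x]
  set A := ∫ x in (0 : ℝ)..1, (φ x + c) with hA
  have hAeq : A = (∫ x in (0 : ℝ)..1, φ x) + c := by
    rw [hA, intervalIntegral.integral_add (φc.intervalIntegrable _ _) (by simp)]
    simp
  have hA1 : 1 ≤ A := by
    have : ∫ _ in (0 : ℝ)..1, (1 : ℝ) ≤ A := intervalIntegral.integral_mono_on zero_le_one
      (by simp) ((φc.add continuous_const).intervalIntegrable _ _) fun x _ => hpos x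
    simpa using this
  have hA0 : A ≠ 0 := by linarith
  have hχ : IsLogLipschitzDensity K fun x => (φ x + c) / A := by
    refine ⟨fun x => div_pos (by linarith [hpos x]) (by linarith), fun x => ?_, fun x y => ?_, ?_⟩
    · simp only [φper x]
    · rw [div_mul_eq_mul_div]
      refine div_le_div_of_nonneg_right ?_ (by linarith)
      have h1 := (abs_le.1 (hφ x y)).2
      have h2 : M * |x - y| ≤ K * |x - y| :=
        mul_le_mul_of_nonneg_right (le_max_left _ _) (abs_nonneg _)
      have h3 := Real.add_one_le_exp (K * |x - y|)
      have h4 : 0 ≤ K * |x - y| := mul_nonneg hK0 (abs_nonneg _)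
      nlinarith [hpos y]
    · rw [intervalIntegral.integral_div, ← hA, div_self hA0]
  have t1 := tendsto_integral_comp_iterate_of_logLipschitz hρ hS hc hper (le_max_right M _) hχ
  have t2 := tendsto_integral_comp_iterate_of_logLipschitz hρ hS hc hper (le_max_right M _)
    (IsLogLipschitzDensity.const_one hK0)
  have t3 := (t1.const_mul A).sub (t2.const_mul c)
  rw [← sub_mul, hAeq, add_sub_cancel_right] at t3
  refine t3.congr fun n => ?_
  have hcn : Continuous fun x => h (S.f^[n] x) := hc.comp (S.f_cont.iterate n)
  rw [← hAeq]
  have i1 : IntervalIntegrable (fun x => A * (h (S.f^[n] x) * ((φ x + c) / A))) volume 0 1 :=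
    (continuous_const.mul (hcn.mul (by fun_prop))).intervalIntegrable _ _
  have i2 : IntervalIntegrable (fun x => c * (h (S.f^[n] x) * 1)) volume 0 1 :=
    (continuous_const.mul (hcn.mul continuous_const)).intervalIntegrable _ _
  rw [← intervalIntegral.integral_const_mul, ← intervalIntegral.integral_const_mul,
    ← intervalIntegral.integral_sub i1 i2]
  refine intervalIntegral.integral_congr fun x _ => ?_
  field_simp
  ring

variable {Φ : UnitAddCircle → UnitAddCircle}

theorem continuous_of_lift (hΦ : ∀ x : ℝ, Φ x = (S.f x : UnitAddCircle)) : Continuous Φ := by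
  refine continuous_of_comp_coe ?_
  exact (continuous_coe.comp S.f_cont).congr fun x => (hΦ x).symm

theorem iterate_coe (hΦ : ∀ x : ℝ, Φ x = (S.f x : UnitAddCircle)) (n : ℕ) (x : ℝ) :
    Φ^[n] (x : UnitAddCircle) = (S.f^[n] x : UnitAddCircle) := by
  induction n generalizing x with
  | zero => rfl
  | succ n ih => rw [Function.iterate_succ_apply, Function.iterate_succ_apply, hΦ, ih]

theorem circleMeasure_isACInvariant (hΦ : ∀ x : ℝ, Φ x = (S.f x : UnitAddCircle))
    (hρ : IsLogLipschitzDensity S.logLip ρ) (hS : S.transfer ρ = ρ) :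
    IsACInvariant Φ (circleMeasure ρ) := by
  refine ⟨circleMeasure_absolutelyContinuous ρ, ?_⟩
  have hc := continuous_of_lift hΦ
  have := hρ.isProbabilityMeasure_circleMeasure
  have := Measure.isProbabilityMeasure_map (μ := circleMeasure ρ) hc.measurable.aemeasurable
  refine ext_of_forall_integral_eq_of_IsFiniteMeasure fun h => ?_
  rw [integral_map hc.measurable.aemeasurable h.continuous.aestronglyMeasurable,
    hρ.integral_circleMeasure (h := fun z => h (Φ z)) (h.continuous.comp hc),
    hρ.integral_circleMeasure h.continuous]
  have := S.integral_comp_f_mul (h := fun x : ℝ => h x) (h.continuous.comp continuous_coe)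
    (periodic_comp_coe h) hρ.continuous hρ.periodic
  simp only [hS] at this
  simpa only [hΦ] using this

/-- The density of an absolutely continuous invariant measure is approximated in `L¹` by Lipschitz
functions, and the push-forwards of these converge to multiples of `ρ`. -/
theorem eq_circleMeasure_of_isACInvariant (hΦ : ∀ x : ℝ, Φ x = (S.f x : UnitAddCircle))
    (hρ : IsLogLipschitzDensity S.logLip ρ) (hS : S.transfer ρ = ρ)
    {ν : Measure UnitAddCircle} [IsProbabilityMeasure ν] (hν : IsACInvariant Φ ν) :
    ν = circleMeasure ρ := by
  have hΦc := continuous_of_lift hΦ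
  have := hρ.isProbabilityMeasure_circleMeasure
  obtain ⟨hac, hinv⟩ := hν
  set g : UnitAddCircle → ℝ := fun z => (ν.rnDeriv volume z).toReal with hg
  have gint : Integrable g := Measure.integrable_toReal_rnDeriv
  have hνn : ∀ n, ν.map Φ^[n] = ν := fun n => by
    induction n with
    | zero => simp
    | succ n ih =>
      rw [Function.iterate_succ', ← Measure.map_map hΦc.measurable (hΦc.measurable.iterate n), ih,
        hinv]
  have hgI : ∀ h : UnitAddCircle → ℝ, ∫ z, h z ∂ν = ∫ z, h z * g z := fun h => by
    rw [← integral_rnDeriv_smul hac]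
    exact integral_congr_ae (ae_of_all _ fun z => by simp [hg, mul_comm])
  -- integrals against `ν` are computed, up to `ε`, by the iterates of a Lipschitz density
  have key : ∀ ε > 0, ∃ φ : ℝ → ℝ, Continuous φ ∧ Function.Periodic φ 1 ∧
      (∃ M, 0 ≤ M ∧ ∀ x y, |φ x - φ y| ≤ M * |x - y|) ∧
      ∀ (h : UnitAddCircle → ℝ) (H : ℝ), Continuous h → (∀ z, |h z| ≤ H) → ∀ n,
        |(∫ z, h z ∂ν) - ∫ x in (0 : ℝ)..1, h (S.f^[n] x) * φ x| ≤ H * ε := by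
    intro ε hε
    obtain ⟨φ₁, h1, h1i⟩ := gint.exists_boundedContinuous_integral_sub_le (half_pos hε)
    obtain ⟨φ, φper, ⟨M, hM, hφM⟩, h2⟩ := (periodic_comp_coe φ₁).exists_lipschitz_approx
      (φ₁.continuous.comp continuous_coe) (half_pos hε)
    have φc : Continuous φ := continuous_of_abs_sub_le hM hφM
    refine ⟨φ, φc, φper, ⟨M, hM, hφM⟩, fun h H hc hH n => ?_⟩
    have hH0 : 0 ≤ H := (abs_nonneg _).trans (hH 0)
    have hcn : Continuous fun z => h (Φ^[n] z) := hc.comp (hΦc.iterate n)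
    have bI : ∀ k : UnitAddCircle → ℝ, Integrable k → Integrable fun z => h (Φ^[n] z) * k z :=
      fun k hk => hk.bdd_mul hcn.aestronglyMeasurable (ae_of_all _ fun z => hH _)
    have e1 : ∫ z, h z ∂ν = ∫ z, h (Φ^[n] z) * g z := by
      conv_lhs => rw [← hνn n]
      rw [integral_map (hΦc.measurable.iterate n).aemeasurable hc.aestronglyMeasurable, hgI]
    have e2 : |(∫ z, h z ∂ν) - ∫ z, h (Φ^[n] z) * φ₁ z| ≤ H * (ε / 2) := by
      rw [e1, ← integral_sub (bI g gint) (bI _ h1i)]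
      calc |∫ z, (h (Φ^[n] z) * g z - h (Φ^[n] z) * φ₁ z)|
          ≤ ∫ z, |h (Φ^[n] z) * g z - h (Φ^[n] z) * φ₁ z| := abs_integral_le_integral_abs
        _ ≤ ∫ z, H * ‖g z - φ₁ z‖ := by
            refine integral_mono ((bI g gint).sub (bI _ h1i)).abs
              ((gint.sub h1i).norm.const_mul H) fun z => ?_
            simp only [← mul_sub, abs_mul]
            exact mul_le_mul_of_nonneg_right (hH _) (abs_nonneg _)
        _ ≤ H * (ε / 2) := by
            rw [integral_const_mul]
            exact mul_le_mul_of_nonneg_left h1 hH0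
    have e3 : ∫ z, h (Φ^[n] z) * φ₁ z = ∫ x in (0 : ℝ)..1, h (S.f^[n] x) * φ₁ x := by
      rw [← UnitAddCircle.intervalIntegral_preimage 0, zero_add]
      simp only [iterate_coe hΦ]
    have hcn' : Continuous fun x : ℝ => h (S.f^[n] x) :=
      hc.comp (continuous_coe.comp (S.f_cont.iterate n))
    have hφ₁c : Continuous fun x : ℝ => φ₁ x := φ₁.continuous.comp continuous_coe
    have e4 : |(∫ x in (0 : ℝ)..1, h (S.f^[n] x) * φ₁ x) - ∫ x in (0 : ℝ)..1, h (S.f^[n] x) * φ x|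
        ≤ H * (ε / 2) := by
      have i1 : IntervalIntegrable (fun x : ℝ => h (S.f^[n] x) * φ₁ x) volume 0 1 :=
        (hcn'.mul hφ₁c).intervalIntegrable _ _
      have i2 : IntervalIntegrable (fun x : ℝ => h (S.f^[n] x) * φ x) volume 0 1 :=
        (hcn'.mul φc).intervalIntegrable _ _
      rw [← intervalIntegral.integral_sub i1 i2]
      have := intervalIntegral.norm_integral_le_of_norm_le_const (a := 0) (b := 1)
        (C := H * (ε / 2)) (f := fun x : ℝ => h (S.f^[n] x) * φ₁ x - h (S.f^[n] x) * φ x)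
        fun x _ => by
          rw [← mul_sub, norm_mul]
          exact mul_le_mul (hH _) (h2 x) (norm_nonneg _) hH0
      simpa using this
    rw [e3] at e2
    calc _ ≤ _ := abs_sub_le _ _ _
      _ ≤ H * (ε / 2) + H * (ε / 2) := add_le_add e2 e4
      _ = H * ε := by ring
  refine ext_of_forall_integral_eq_of_IsFiniteMeasure fun h => ?_
  set H := ‖h‖ with hHdef
  have hH : ∀ z, |h z| ≤ H := fun z => h.norm_coe_le_norm z
  have hH0 : 0 ≤ H := norm_nonneg _
  rw [hρ.integral_circleMeasure h.continuous]
  set I := ∫ x in (0 : ℝ)..1, h x * ρ x with hI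
  have hIH : |I| ≤ H := by
    rw [hI, ← hρ.integral_circleMeasure h.continuous]
    simpa using norm_integral_le_of_norm_le_const (μ := circleMeasure ρ) (f := h) (ae_of_all _ hH)
  by_contra hne
  have hpos : 0 < |(∫ z, h z ∂ν) - I| := abs_pos.2 (sub_ne_zero.2 hne)
  obtain ⟨φ, φc, φper, ⟨M, hM, hφM⟩, hφ⟩ :=
    key (|(∫ z, h z ∂ν) - I| / (2 * H + 1) / 2) (by positivity)
  set ε := |(∫ z, h z ∂ν) - I| / (2 * H + 1) / 2 with hε
  have hε0 : 0 < ε := by positivity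
  have l1 : |(∫ z, h z ∂ν) - (∫ x in (0 : ℝ)..1, φ x) * I| ≤ H * ε := by
    have t := tendsto_integral_comp_iterate_of_lipschitz hρ hS (h := fun x : ℝ => h x)
      (h.continuous.comp continuous_coe) (periodic_comp_coe h) φc φper hM hφM
    exact le_of_tendsto (tendsto_const_nhds.sub t).abs
      (Eventually.of_forall fun n => hφ h H h.continuous hH n)
  have l2 : |1 - ∫ x in (0 : ℝ)..1, φ x| ≤ ε := by
    simpa using hφ (fun _ => 1) 1 continuous_const (by simp) 0
  have l3 : |(∫ x in (0 : ℝ)..1, φ x) * I - I| ≤ ε * H := by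
    rw [← sub_one_mul, abs_mul, abs_sub_comm]
    exact mul_le_mul l2 hIH (abs_nonneg _) hε0.le
  have l4 := abs_sub_le (∫ z, h z ∂ν) ((∫ x in (0 : ℝ)..1, φ x) * I) I
  have l5 : |(∫ z, h z ∂ν) - I| = ε * (2 * (2 * H + 1)) := by
    rw [hε]; field_simp
  nlinarith

end ExpandingLift

/-! ### The lift of an expanding circle map -/

section Lift

theorem exists_int_of_coe_eq {x y : ℝ} (h : (x : UnitAddCircle) = y) : ∃ n : ℤ, x - y = n := by
  have h0 : ((x - y : ℝ) : UnitAddCircle) = 0 := by rw [AddCircle.coe_sub, h, sub_self]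
  obtain ⟨n, hn⟩ := AddCircle.coe_eq_zero_iff (1 : ℝ) |>.1 h0
  exact ⟨n, by simpa using hn.symm⟩

/-- The degree of a circle map. -/
theorem exists_degree {Φ : UnitAddCircle → UnitAddCircle} {f : ℝ → ℝ} (hf : Continuous f)
    (hΦ : ∀ x : ℝ, Φ (x : UnitAddCircle) = (f x : UnitAddCircle)) :
    ∃ e : ℤ, ∀ x, f (x + 1) = f x + e := by
  have h1 : ∀ x : ℝ, ∃ n : ℤ, f (x + 1) - f x = n := fun x => by
    refine exists_int_of_coe_eq ?_
    rw [← hΦ, ← hΦ]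
    exact congrArg Φ (periodic_comp_coe id x)
  choose n hn using h1
  have nc : Continuous n := by
    refine Int.isClosedEmbedding_coe_real.isInducing.continuous_iff.2 ?_
    have : Continuous fun x => f (x + 1) - f x := by fun_prop
    exact this.congr hn
  refine ⟨n 0, fun x => ?_⟩
  rw [← PreconnectedSpace.constant inferInstance nc (x := x) (y := 0), ← hn x]
  ring

/-- The derivative has constant sign, as it does not vanish. -/
theorem exists_sign {g : ℝ → ℝ} (hg : Continuous g) (h : ∀ x, 1 < |g x|) :
    ∃ s : ℤ, (s = 1 ∨ s = -1) ∧ ∀ x, g x = s * |g x| := by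
  by_cases h0 : 0 < g 0
  · refine ⟨1, Or.inl rfl, fun x => ?_⟩
    rw [Int.cast_one, one_mul, abs_of_nonneg]
    by_contra! hx
    obtain ⟨c, hc⟩ := mem_range_of_exists_le_of_exists_ge hg ⟨x, hx.le⟩ ⟨0, h0.le⟩
    have := h c
    rw [hc, abs_zero] at this
    linarith
  · refine ⟨-1, Or.inr rfl, fun x => ?_⟩
    have : g x ≤ 0 := by
      by_contra! hx
      obtain ⟨c, hc⟩ := mem_range_of_exists_le_of_exists_ge hg ⟨0, not_lt.1 h0⟩ ⟨x, hx.le⟩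
      have := h c
      rw [hc, abs_zero] at this
      linarith
    rw [abs_of_nonpos this]
    push_cast
    ring

theorem abs_sub_le_of_one_le_abs_deriv {f : ℝ → ℝ} (hf : Differentiable ℝ f)
    (h : ∀ x, 1 ≤ |deriv f x|) (a b : ℝ) : |a - b| ≤ |f a - f b| := by
  wlog hab : a < b generalizing a b
  · rcases (not_lt.1 hab).eq_or_lt with rfl | hlt
    · simp
    · rw [abs_sub_comm, abs_sub_comm (f a)]
      exact this b a hlt
  obtain ⟨c, -, hc⟩ := exists_deriv_eq_slope f hab hf.continuous.continuousOn
    hf.differentiableOn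
  have h1 := h c
  rw [hc, abs_div, one_le_div (abs_pos.2 (by linarith))] at h1
  rwa [abs_sub_comm, abs_sub_comm (f a)]

/-- Every `C²` expanding map has a lift with the data of `ExpandingLift`; the bounds on `p = |ψ'|`
and on its distortion come from the compactness of the circle. -/
theorem IsC2Expanding.exists_expandingLift {Φ : UnitAddCircle → UnitAddCircle}
    (hΦ : IsC2Expanding Φ) :
    ∃ S : ExpandingLift, ∀ x : ℝ, Φ (x : UnitAddCircle) = (S.f x : UnitAddCircle) := by
  obtain ⟨f, hf2, hlift, hexp⟩ := hΦ
  have hfd : Differentiable ℝ f := hf2.differentiable (by norm_num)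
  have hfc := hfd.continuous
  have hf1 : ContDiff ℝ 1 (deriv f) := by
    have : ContDiff ℝ (1 + 1) f := by simpa [one_add_one_eq_two] using hf2
    exact (contDiff_succ_iff_deriv.1 this).2.2
  have hf'c : Continuous (deriv f) := hf1.continuous
  have hf'd : Differentiable ℝ (deriv f) := hf1.differentiable (by norm_num)
  have hf''c : Continuous (deriv (deriv f)) := hf1.continuous_deriv (by norm_num)
  obtain ⟨e, he⟩ := exists_degree hfc hlift
  obtain ⟨s, hs, hsf⟩ := exists_sign hf'c hexp
  have hss : (s : ℝ) * s = 1 := by rcases hs with h | h <;> simp [h]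
  have hper : Function.Periodic (deriv f) 1 := fun x => by
    rw [← deriv_comp_add_const]
    have : (fun x => f (x + 1)) = fun x => f x + e := funext he
    rw [this, deriv_add_const]
  have hper' : Function.Periodic (deriv (deriv f)) 1 := fun x => by
    rw [← deriv_comp_add_const]
    have : (fun x => deriv f (x + 1)) = deriv f := funext hper
    rw [this]
  have hek : ∀ x (k : ℤ), f (x + k) = f x + e * k := fun x k => by
    have hp : Function.Periodic (fun x => f x - e * x) 1 := fun x => by
      simp only [he]; ring
    have := hp.int_mul k x
    simp only [mul_one] at this
    linarith
  -- the degree has the sign of the derivative and is at least `2` in absolute value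
  have hse : (1 : ℝ) < s * e := by
    obtain ⟨c, -, hc⟩ := exists_deriv_eq_slope f zero_lt_one hfc.continuousOn hfd.differentiableOn
    have h01 := he 0
    rw [zero_add] at h01
    rw [h01, add_sub_cancel_left, sub_zero, div_one] at hc
    rw [← hc, hsf c, ← mul_assoc, hss, one_mul]
    exact hexp c
  have hse' : 1 < s * e := by exact_mod_cast hse
  obtain ⟨D, hD⟩ := Int.eq_ofNat_of_zero_le (show 0 ≤ s * e by linarith)
  have hDe : (D : ℝ) = s * e := by exact_mod_cast hD.symm
  have hexpand := abs_sub_le_of_one_le_abs_deriv hfd fun x => (hexp x).le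
  have hinj : Function.Injective f := fun a b hab => by
    have := hexpand a b
    rw [hab, sub_self, abs_zero] at this
    exact sub_eq_zero.1 (abs_nonpos_iff.1 this)
  have hsurj : Function.Surjective f := fun y => by
    have he2 : (1 : ℝ) ≤ (e : ℝ) * e := by
      have : (e : ℝ) * e = (s * e) * (s * e) := by linear_combination -(e : ℝ) * e * hss
      rw [this]; nlinarith
    have h1 := Int.le_ceil |y - f 0|
    have h2 : 0 ≤ (⌈|y - f 0|⌉ : ℝ) := (abs_nonneg _).trans h1
    have h3 : (⌈|y - f 0|⌉ : ℝ) ≤ e * e * ⌈|y - f 0|⌉ := le_mul_of_one_le_left h2 he2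
    refine mem_range_of_exists_le_of_exists_ge hfc
      ⟨0 + (-(e * ⌈|y - f 0|⌉) : ℤ), ?_⟩ ⟨0 + (e * ⌈|y - f 0|⌉ : ℤ), ?_⟩
    · rw [hek]; push_cast
      linarith [neg_abs_le (y - f 0)]
    · rw [hek]; push_cast
      linarith [le_abs_self (y - f 0)]
  obtain ⟨ψ, hψl, hψr⟩ := Function.bijective_iff_has_inverse.1 ⟨hinj, hsurj⟩
  have hψlip : ∀ x y, |ψ x - ψ y| ≤ |x - y| := fun x y => by
    have := hexpand (ψ x) (ψ y)
    rwa [hψr, hψr] at this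
  have hψc : Continuous ψ := continuous_of_abs_sub_le zero_le_one fun x y => by
    rw [one_mul]; exact hψlip x y
  obtain ⟨C, hC0, hC⟩ := hper'.exists_abs_le hf''c
  have hf'lip : ∀ x y, |deriv f x - deriv f y| ≤ C * |x - y| := fun x y =>
    Convex.norm_image_sub_le_of_norm_deriv_le (s := Set.univ) (fun z _ => hf'd z)
      (fun z _ => hC z) convex_univ trivial trivial
  have hinvc : Continuous fun x => |deriv f x|⁻¹ :=
    hf'c.abs.inv₀ fun x => by have := hexp x; positivity
  have hinvper : Function.Periodic (fun x => |deriv f x|⁻¹) 1 := fun x => by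
    simp only [hper x]
  obtain ⟨z, -, hz⟩ := isCompact_univ.exists_isMaxOn Set.univ_nonempty
    (hinvper.continuous_lift hinvc).continuousOn
  obtain ⟨x₀, rfl⟩ := QuotientAddGroup.mk_surjective z
  have hθ : ∀ x, |deriv f x|⁻¹ ≤ |deriv f x₀|⁻¹ := fun x =>
    hz (Set.mem_univ ((x : ℝ) : UnitAddCircle))
  have hψadd : ∀ y, ψ (y + D) = ψ y + s := fun y => hinj <| by
    rw [hψr, hek, hψr, hDe]; ring
  refine ⟨{
    f := f, ψ := ψ, p := fun y => |deriv f (ψ y)|⁻¹, D := D, σ := s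
    θ := |deriv f x₀|⁻¹, κ := C
    sign := ?_
    two_le := by omega
    θ_lt_one := inv_lt_one_of_one_lt₀ (hexp x₀)
    κ_nonneg := hC0.le
    p_pos := fun y => inv_pos.2 (by linarith [hexp (ψ y)])
    p_le := fun y => hθ (ψ y)
    p_cont := hinvc.comp hψc
    p_distortion := fun x y => ?_
    p_periodic := fun y => ?_
    f_cont := hfc
    f_ψ := hψr
    ψ_f := hψl
    ψ_deriv := fun y => ?_
    ψ_add := hψadd }, hlift⟩
  · rcases hs with h | h <;> simp [h]
  · have hx := hexp (ψ x)
    have hy := hexp (ψ y)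
    have h0 : 0 < |deriv f (ψ x)| := by linarith
    have h0' : 0 < |deriv f (ψ y)| := by linarith
    have h1 : |deriv f (ψ y)| ≤ |deriv f (ψ x)| + C * |x - y| := by
      have h2 := hf'lip (ψ y) (ψ x)
      have h3 := hψlip y x
      rw [abs_sub_comm y x] at h3
      have h4 := mul_le_mul_of_nonneg_left h3 hC0.le
      have h5 := abs_sub_abs_le_abs_sub (deriv f (ψ y)) (deriv f (ψ x))
      linarith
    have h2 := Real.add_one_le_exp (C * |x - y|)
    have h3 : 0 ≤ C * |x - y| := by positivity
    rw [inv_mul_eq_div, inv_eq_one_div, div_le_div_iff₀ h0 h0']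
    nlinarith
  · have : Function.Periodic (fun y => |deriv f y|⁻¹) s := by
      rcases hs with h | h
      · simpa [h] using hinvper
      · simpa [h] using hinvper.neg
    simp only [hψadd]
    exact this (ψ y)
  · have h0 : deriv f (ψ y) ≠ 0 := by
      have := hexp (ψ y)
      rw [← abs_pos]; linarith
    have h1 := HasDerivAt.of_local_left_inverse hψc.continuousAt (hfd (ψ y)).hasDerivAt h0
      (Eventually.of_forall hψr)
    have h2 : (deriv f (ψ y))⁻¹ = s * |deriv f (ψ y)|⁻¹ := by
      conv_lhs => rw [hsf (ψ y)]
      rw [mul_inv]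
      congr 1
      rcases hs with h | h <;> simp [h]
    rwa [h2] at h1

end Lift

/-! ### Vector fields with invariant flux -/

namespace ExpandingLift

variable (S : ExpandingLift)

theorem periodic_p_comp_f : Function.Periodic (fun x => S.p (S.f x)) 1 := by
  intro x
  have := S.f_add_int x 1
  rw [Int.cast_one, mul_one] at this
  simp only [this]
  rcases S.sign with h | h
  · rw [h, one_mul]; exact S.p_periodic _
  · rw [h, neg_one_mul, ← sub_eq_add_neg]; exact S.p_periodic.sub_eq _

/-- The solution of `v = w + (v ∘ f) / f'`, with `1 / f' = σ * (p ∘ f)`, is the sum of a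
geometrically convergent series. -/
theorem exists_eq_add_pullback {w : ℝ → ℝ} (hw : Continuous w) (hper : Function.Periodic w 1) :
    ∃ v : ℝ → ℝ, Continuous v ∧ Function.Periodic v 1 ∧
      ∀ x, v x = w x + S.σ * S.p (S.f x) * v (S.f x) := by
  obtain ⟨B, hB0, hB⟩ := hper.exists_abs_le hw
  set t : ℕ → ℝ → ℝ := fun k => Nat.rec w (fun _ tk x => S.σ * S.p (S.f x) * tk (S.f x)) k with ht
  have t0 : t 0 = w := rfl
  have ts : ∀ k x, t (k + 1) x = S.σ * S.p (S.f x) * t k (S.f x) := fun k x => rfl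
  have tc : ∀ k, Continuous (t k) := fun k => by
    induction k with
    | zero => exact hw
    | succ k ih =>
      have h1 := S.f_cont
      have h2 := S.p_cont
      show Continuous fun x => S.σ * S.p (S.f x) * t k (S.f x)
      fun_prop
  have tper : ∀ k, Function.Periodic (t k) 1 := fun k => by
    induction k with
    | zero => exact hper
    | succ k ih =>
      intro x
      rw [ts, ts]
      have h1 := S.periodic_comp_f ih x
      have h2 := S.periodic_p_comp_f x
      simp only at h1 h2
      rw [h1, h2]
  have tb : ∀ k x, ‖t k x‖ ≤ B * S.θ ^ k := fun k => by
    induction k with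
    | zero => intro x; rw [pow_zero, mul_one]; exact hB x
    | succ k ih =>
      intro x
      rw [ts, norm_mul, norm_mul, Real.norm_eq_abs S.σ, S.abs_σ, one_mul, Real.norm_eq_abs,
        abs_of_pos (S.p_pos _)]
      calc S.p (S.f x) * ‖t k (S.f x)‖ ≤ S.θ * (B * S.θ ^ k) :=
            mul_le_mul (S.p_le _) (ih _) (norm_nonneg _) S.θ_pos.le
        _ = B * S.θ ^ (k + 1) := by ring
  have hsum : Summable fun k => B * S.θ ^ k :=
    (summable_geometric_of_lt_one S.θ_pos.le S.θ_lt_one).mul_left B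
  have hsx : ∀ x, Summable fun k => t k x := fun x =>
    Summable.of_norm_bounded hsum fun k => tb k x
  refine ⟨fun x => ∑' k, t k x, continuous_tsum tc hsum tb, fun x => ?_, fun x => ?_⟩
  · simp only [tper _ x]
  · show ∑' k, t k x = w x + S.σ * S.p (S.f x) * ∑' k, t k (S.f x)
    rw [(hsx x).tsum_eq_zero_add, t0]
    simp only [ts, tsum_mul_left]

variable {S} {ρ : ℝ → ℝ}

/-- If the `w`-parts of `v = w + (v ∘ f) / f'` cancel over the fibres of the map, then the flux
`ρ v` is transported to itself. -/
theorem sum_flux_eq (hS : S.transfer ρ = ρ) {v w : ℝ → ℝ} (hv : Function.Periodic v 1)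
    (hvw : ∀ x, v x = w x + S.σ * S.p (S.f x) * v (S.f x))
    (hw : ∀ y, ∑ j ∈ Finset.range S.D, ρ (S.ψ (y + j)) * w (S.ψ (y + j)) = 0) (y : ℝ) :
    S.σ * ∑ j ∈ Finset.range S.D, ρ (S.ψ (y + j)) * v (S.ψ (y + j)) = ρ y * v y := by
  have h1 : ∀ j : ℕ, ρ (S.ψ (y + j)) * v (S.ψ (y + j)) = ρ (S.ψ (y + j)) * w (S.ψ (y + j)) +
      S.σ * v y * (S.p (y + j) * ρ (S.ψ (y + j))) := fun j => by
    have : v (y + j) = v y := by simpa using hv.nat_mul j y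
    rw [hvw (S.ψ (y + j)), S.f_ψ, this]; ring
  simp_rw [h1]
  rw [Finset.sum_add_distrib, hw, zero_add, ← Finset.mul_sum, ← transfer_apply, hS]
  linear_combination (v y * ρ y) * S.σ_mul_σ

/-- There are arbitrarily many independent vector fields whose flux is transported to itself. The
`w`-parts are `(t (f x) - t (f x + 1)) cos (2π f x) ^ i / ρ x` with `t z = cos (2π z / D)`: the
factor `t z - t (z + 1)` makes the sums over the fibres telescope. -/
theorem exists_invariant_fields {K : ℝ} (hρ : IsLogLipschitzDensity K ρ)
    (hS : S.transfer ρ = ρ) (n : ℕ) :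
    ∃ v : Fin n → ℝ → ℝ, (∀ i, Continuous (v i)) ∧ (∀ i, Function.Periodic (v i) 1) ∧
      (∀ i y, S.σ * ∑ j ∈ Finset.range S.D, ρ (S.ψ (y + j)) * v i (S.ψ (y + j)) = ρ y * v i y) ∧
      ∀ (a : Fin n → ℝ) (c : ℝ), (∀ x, ∑ i, a i * (ρ x * v i x) = c) → a = 0 := by
  have hD0 : (0 : ℝ) < S.D := by have := S.two_le; positivity
  have hD2 : (2 : ℝ) ≤ S.D := by exact_mod_cast S.two_le
  set t : ℝ → ℝ := fun z => Real.cos (2 * Real.pi * z / S.D) with ht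
  set s : ℝ → ℝ := fun z => t z - t (z + 1) with hs
  set C : ℝ → ℝ := fun z => Real.cos (2 * Real.pi * z) with hC
  have tper : Function.Periodic t S.D := fun z => by
    simp only [ht]
    rw [show 2 * Real.pi * (z + S.D) / S.D = 2 * Real.pi * z / S.D + 2 * Real.pi by field_simp]
    exact Real.cos_add_two_pi _
  have Cper : Function.Periodic C 1 := fun z => by
    simp only [hC, mul_add, mul_one]
    exact Real.cos_add_two_pi _
  have tc : Continuous t := by fun_prop
  have sc : Continuous s := by fun_prop
  have Cc : Continuous C := by fun_prop
  set w : Fin n → ℝ → ℝ := fun i x => s (S.f x) * C (S.f x) ^ (i : ℕ) / ρ x with hw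
  have hfc := S.f_cont
  have hρc := hρ.continuous
  have hρ0 : ∀ x, ρ x ≠ 0 := fun x => (hρ.pos x).ne'
  have wc : ∀ i, Continuous (w i) := fun i => by
    have : Continuous fun x => s (S.f x) * C (S.f x) ^ (i : ℕ) := by fun_prop
    exact this.div hρc hρ0
  have sper : Function.Periodic s S.D := fun z => by
    simp only [hs]
    rw [add_right_comm, tper, tper]
  have wper : ∀ i, Function.Periodic (w i) 1 := fun i x => by
    have h1 := S.f_add_int x 1
    rw [Int.cast_one, mul_one] at h1
    have h2 := S.periodic_comp_f Cper x
    simp only at h2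
    rw [h1] at h2
    simp only [hw, h2, hρ.periodic x, h1]
    congr 2
    rcases S.sign with h | h
    · rw [h, one_mul]; exact sper _
    · rw [h, neg_one_mul, ← sub_eq_add_neg]; exact sper.sub_eq _
  have wsum : ∀ i y, ∑ j ∈ Finset.range S.D, ρ (S.ψ (y + j)) * w i (S.ψ (y + j)) = 0 := by
    intro i y
    have h1 : ∀ j : ℕ, ρ (S.ψ (y + j)) * w i (S.ψ (y + j)) =
        C y ^ (i : ℕ) * (t (y + j) - t (y + (j + 1 : ℕ))) := fun j => by
      have h2 : C (y + j) = C y := by simpa using Cper.nat_mul j y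
      simp only [hw, S.f_ψ, h2, mul_div_cancel₀ _ (hρ0 _), hs]
      push_cast
      rw [add_assoc]
      ring
    simp_rw [h1]
    rw [← Finset.mul_sum, Finset.sum_range_sub' (fun j : ℕ => t (y + j)), tper]
    simp
  choose v vc vper hvw using fun i => S.exists_eq_add_pullback (wc i) (wper i)
  have vfix := fun i => sum_flux_eq hS (vper i) (hvw i) (wsum i)
  refine ⟨v, vc, vper, vfix, fun a c hac => ?_⟩
  -- a constant flux which is transported to itself vanishes, since `σ D ≠ 1`
  have hc0 : c = 0 := by
    have h1 : S.σ * ∑ j ∈ Finset.range S.D, c = c := by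
      conv_rhs => rw [← hac 0]
      rw [← Finset.sum_congr rfl fun (j : ℕ) _ => hac (S.ψ (0 + j)), Finset.sum_comm,
        Finset.mul_sum]
      refine Finset.sum_congr rfl fun i _ => ?_
      rw [← Finset.mul_sum, ← vfix]; ring
    rw [Finset.sum_const, Finset.card_range, nsmul_eq_mul] at h1
    rcases S.sign with h | h <;> rw [h] at h1 <;> nlinarith
  have hv0 : ∀ x, ∑ i, a i * v i x = 0 := fun x => by
    have h1 : ρ x * ∑ i, a i * v i x = 0 := by
      rw [Finset.mul_sum, ← hc0, ← hac x]
      exact Finset.sum_congr rfl fun i _ => by ring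
    exact (mul_eq_zero.1 h1).resolve_left (hρ0 x)
  have hw0 : ∀ x, ∑ i, a i * w i x = 0 := fun x => by
    have h1 : ∀ i, a i * w i x = a i * v i x - S.σ * S.p (S.f x) * (a i * v i (S.f x)) :=
      fun i => by rw [hvw i x]; ring
    simp_rw [h1]
    rw [Finset.sum_sub_distrib, ← Finset.mul_sum, hv0, hv0]
    ring
  have hz0 : ∀ z, s z * ∑ i : Fin n, C z ^ (i : ℕ) * a i = 0 := fun z => by
    have h1 : ρ (S.ψ z) * ∑ i, a i * w i (S.ψ z) = 0 := by rw [hw0, mul_zero]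
    rw [← h1, Finset.mul_sum, Finset.mul_sum]
    refine Finset.sum_congr rfl fun i _ => ?_
    simp only [hw, S.f_ψ]
    field_simp [hρ0 (S.ψ z)]
  have hs0 : s 0 ≠ 0 := by
    have h1 : s 0 = 1 - Real.cos (2 * Real.pi / S.D) := by simp [hs, ht]
    rw [h1, sub_ne_zero]
    refine (ne_of_lt ?_).symm
    rw [← Real.cos_zero]
    refine Real.cos_lt_cos_of_nonneg_of_le_pi le_rfl ?_ (by positivity)
    rw [div_le_iff₀ hD0]
    nlinarith [Real.pi_pos]
  obtain ⟨δ, hδ, hsδ⟩ := Metric.eventually_nhds_iff.1 (sc.continuousAt.eventually_ne hs0)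
  -- the Vandermonde matrix at `n` points near `0`
  set r := min δ (1 / 2) with hr
  have hr0 : 0 < r := lt_min hδ (by norm_num)
  set z : Fin n → ℝ := fun j => r * (j / (n + 1)) with hz
  have hzr : ∀ j, 0 ≤ z j ∧ z j < r := fun j => by
    have h1 : (j : ℝ) < n + 1 := by
      have : (j : ℝ) < n := by exact_mod_cast j.2
      linarith
    have h2 : (0 : ℝ) < n + 1 := by positivity
    refine ⟨by positivity, mul_lt_of_lt_one_right hr0 ((div_lt_one h2).2 h1)⟩
  refine Matrix.eq_zero_of_forall_index_sum_pow_mul_eq_zero (f := fun j => C (z j)) ?_ fun j => ?_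
  · intro j k hjk
    have hmem : ∀ j, 2 * Real.pi * z j ∈ Set.Icc 0 Real.pi := fun j => by
      have h1 := hzr j
      have h2 : r ≤ 1 / 2 := min_le_right _ _
      have := Real.pi_pos
      constructor
      · exact mul_nonneg (by positivity) h1.1
      · nlinarith
    have h1 := Real.injOn_cos (hmem j) (hmem k) hjk
    have h2 : z j = z k := mul_left_cancel₀ (by positivity) h1
    have h3 := mul_left_cancel₀ hr0.ne' h2
    have h4 : (j : ℝ) = k := (div_left_inj' (by positivity)).1 h3
    exact Fin.ext (by exact_mod_cast h4)
  · refine (mul_eq_zero.1 (hz0 (z j))).resolve_left (hsδ ?_)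
    rw [Real.dist_eq, sub_zero, abs_of_nonneg (hzr j).1]
    exact (hzr j).2.trans_le (min_le_left _ _)

end ExpandingLift

/-! ### First-order expansion of lifted distribution functions -/

section LinearField

variable {n : ℕ}

/-- The vector field `∑ i, a i • v i`, as a function on `ℝ`. -/
noncomputable def linearField (v : Fin n → ℝ → ℝ) (a : EuclideanSpace ℝ (Fin n)) (x : ℝ) : ℝ :=
  ∑ i, a i * v i x

variable {v : Fin n → ℝ → ℝ}

theorem linearField_sub (a b : EuclideanSpace ℝ (Fin n)) (x : ℝ) :
    linearField v (a - b) x = linearField v a x - linearField v b x := by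
  simp only [linearField, PiLp.sub_apply, sub_mul, Finset.sum_sub_distrib]

theorem linearField_smul (c : ℝ) (a : EuclideanSpace ℝ (Fin n)) (x : ℝ) :
    linearField v (c • a) x = c * linearField v a x := by
  simp only [linearField, PiLp.smul_apply, smul_eq_mul, Finset.mul_sum, mul_assoc]

theorem linearField_zero (x : ℝ) : linearField v 0 x = 0 := by simp [linearField]

theorem linearField_mul_left (ρ : ℝ → ℝ) (a : EuclideanSpace ℝ (Fin n)) (x : ℝ) :
    linearField (fun i x => ρ x * v i x) a x = ρ x * linearField v a x := by
  simp only [linearField, Finset.mul_sum]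
  exact Finset.sum_congr rfl fun i _ => by ring

theorem linearField_continuous_uncurry (hc : ∀ i, Continuous (v i)) :
    Continuous fun q : EuclideanSpace ℝ (Fin n) × ℝ => linearField v q.1 q.2 := by
  unfold linearField
  fun_prop

theorem linearField_continuous (hc : ∀ i, Continuous (v i)) (a : EuclideanSpace ℝ (Fin n)) :
    Continuous (linearField v a) :=
  (linearField_continuous_uncurry hc).comp (continuous_const.prodMk continuous_id)

theorem linearField_periodic (hp : ∀ i, Function.Periodic (v i) 1)
    (a : EuclideanSpace ℝ (Fin n)) : Function.Periodic (linearField v a) 1 := fun x => by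
  simp only [linearField, hp _ x]

theorem exists_abs_linearField_le (hc : ∀ i, Continuous (v i))
    (hp : ∀ i, Function.Periodic (v i) 1) :
    ∃ V > 0, ∀ a x, |linearField v a x| ≤ V * ‖a‖ := by
  choose B hB0 hB using fun i => (hp i).exists_abs_le (hc i)
  refine ⟨∑ i, B i + 1, add_pos_of_nonneg_of_pos (Finset.sum_nonneg fun i _ => (hB0 i).le) one_pos,
    fun a x => ?_⟩
  calc |linearField v a x| ≤ ∑ i, |a i * v i x| := Finset.abs_sum_le_sum_abs _ _
    _ ≤ ∑ i, ‖a‖ * B i := Finset.sum_le_sum fun i _ => by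
        rw [abs_mul]
        exact mul_le_mul (PiLp.norm_apply_le a i) (hB i x) (abs_nonneg _) (norm_nonneg _)
    _ ≤ (∑ i, B i + 1) * ‖a‖ := by
        rw [← Finset.mul_sum]
        nlinarith [norm_nonneg a]

theorem exists_modulus_linearField (hc : ∀ i, Continuous (v i))
    (hp : ∀ i, Function.Periodic (v i) 1) {ε : ℝ} (hε : 0 < ε) :
    ∃ δ > 0, ∀ a x y, |x - y| < δ → |linearField v a x - linearField v a y| ≤ ε * ‖a‖ := by
  have h1 : ∀ i, ∀ᶠ δ in 𝓝[>] (0 : ℝ), ∀ x y, |x - y| < δ → |v i x - v i y| < ε / (n + 1) := by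
    intro i
    obtain ⟨δ, hδ, h⟩ := (hp i).exists_modulus (hc i) (ε := ε / (n + 1)) (by positivity)
    filter_upwards [Ioo_mem_nhdsGT hδ] with δ' hδ' x y hxy
    exact h x y (hxy.trans hδ'.2)
  obtain ⟨δ, hδ, hδ0⟩ := ((eventually_all.2 h1).and self_mem_nhdsWithin).exists
  refine ⟨δ, hδ0, fun a x y hxy => ?_⟩
  have e : linearField v a x - linearField v a y = ∑ i, a i * (v i x - v i y) := by
    simp only [linearField, mul_sub, Finset.sum_sub_distrib]
  rw [e]
  calc |∑ i, a i * (v i x - v i y)| ≤ ∑ i, |a i * (v i x - v i y)| :=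
        Finset.abs_sum_le_sum_abs _ _
    _ ≤ ∑ _i : Fin n, ‖a‖ * (ε / (n + 1)) := Finset.sum_le_sum fun i _ => by
        rw [abs_mul]
        exact mul_le_mul (PiLp.norm_apply_le a i) (hδ i x y hxy).le (abs_nonneg _) (norm_nonneg _)
    _ ≤ ε * ‖a‖ := by
        rw [Finset.sum_const, Finset.card_univ, Fintype.card_fin, nsmul_eq_mul]
        have h2 : (n : ℝ) * (‖a‖ * (ε / (n + 1))) = (n / (n + 1)) * (ε * ‖a‖) := by ring
        rw [h2]
        refine mul_le_of_le_one_left (by positivity) ?_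
        rw [div_le_one (by positivity)]
        linarith

end LinearField

/-- The lifted cumulative distribution function of `g` is within `η` of `h`, up to a constant. -/
def IsApproxCDF {Ω : Type} [MeasurableSpace Ω] (m : Measure Ω) (g : Ω → ℝ) (h : ℝ → ℝ) (η : ℝ) :
    Prop :=
  ∃ c, ∀ y, |liftedCDF m g y - (h y + c)| ≤ η

section ApproxCDF

variable {Ω : Type} [MeasurableSpace Ω] {m : Measure Ω} [IsProbabilityMeasure m]

/-- Two laws with the same approximate lifted cumulative distribution function are close, when this
function increases fast enough. -/
theorem IsApproxCDF.wasserstein_le {g₁ g₂ : Ω → ℝ} {h : ℝ → ℝ} {η s : ℝ}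
    (h₁ : IsApproxCDF m g₁ h η) (h₂ : IsApproxCDF m g₂ h η) (m₁ : Measurable g₁)
    (m₂ : Measurable g₂) (i₁ : Integrable g₁ m) (i₂ : Integrable g₂ m) (hs : 0 ≤ s)
    (hh : ∀ y, h y + 2 * η ≤ h (y + s)) :
    wasserstein (m.map fun ω => (g₁ ω : UnitAddCircle)) (m.map fun ω => (g₂ ω : UnitAddCircle))
      ≤ s := by
  obtain ⟨c₁, hc₁⟩ := h₁
  obtain ⟨c₂, hc₂⟩ := h₂
  refine wasserstein_map_coe_le m₁ m₂ i₁ i₂ (c := c₁ - c₂) hs (fun y => ?_) fun y => ?_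
  · have a := abs_le.1 (hc₁ y)
    have b := abs_le.1 (hc₂ (y + s))
    linarith [hh y]
  · have a := abs_le.1 (hc₂ y)
    have b := abs_le.1 (hc₁ (y + s))
    linarith [hh y]

/-- Whether `x + v x` lies below `y` modulo `1` is decided, up to `ω`, by the value of `v` at `y`
instead of `x`. This needs no monotonicity of `x ↦ x + v x`. -/
theorem floor_sandwich {v : ℝ → ℝ} (hper : Function.Periodic v 1) {τ ω : ℝ} (hω : 0 ≤ ω)
    (hτ : ∀ x, |v x| ≤ τ) (hmod : ∀ x y, |x - y| ≤ τ → |v x - v y| ≤ ω) (x y : ℝ) :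
    ⌊y - v y - ω - x⌋ ≤ ⌊y - (x + v x)⌋ ∧ ⌊y - (x + v x)⌋ ≤ ⌊y - v y + ω - x⌋ := by
  have hk : ∀ k : ℤ, v (x + k) = v x := fun k => by simpa using hper.int_mul k x
  constructor
  · rw [Int.le_floor]
    set k := ⌊y - v y - ω - x⌋
    have h1 : (k : ℝ) ≤ y - v y - ω - x := Int.floor_le _
    rw [← hk k]
    have hy := abs_le.1 (hτ y)
    have hx := abs_le.1 (hτ (x + k))
    by_cases h2 : x + k ≤ y - τ
    · linarith
    · have h3 := abs_le.1 (hmod (x + k) y (abs_le.2 ⟨by linarith, by linarith⟩))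
      linarith
  · rw [Int.le_floor]
    set k := ⌊y - (x + v x)⌋
    have h1 : (k : ℝ) ≤ y - (x + v x) := Int.floor_le _
    rw [← hk k] at h1
    have hy := abs_le.1 (hτ y)
    have hx := abs_le.1 (hτ (x + k))
    by_cases h2 : x + k ≤ y - τ
    · linarith
    · have h3 := abs_le.1 (hmod (x + k) y (abs_le.2 ⟨by linarith, by linarith⟩))
      linarith

end ApproxCDF

namespace IsLogLipschitzDensity

variable {K : ℝ} {ρ : ℝ → ℝ}

theorem liftedCDF_id (h : IsLogLipschitzDensity K ρ) (y : ℝ) :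
    liftedCDF (densityMeasure ρ) (fun x => x) y = (∫ t in (0 : ℝ)..y, ρ t) - 1 := by
  rw [liftedCDF, h.integral_densityMeasure (fun x => (⌊y - x⌋ : ℝ)),
    integral_floor_sub_mul h.continuous h.periodic h.mass]

/-- First-order expansion of the primitive of the density. -/
theorem abs_integral_sub_le (h : IsLogLipschitzDensity K ρ) {y t τ o : ℝ} (ht : |t| ≤ τ)
    (hmod : ∀ x, |x - y| ≤ τ → |ρ x - ρ y| ≤ o) :
    |(∫ x in (0 : ℝ)..y + t, ρ x) - (∫ x in (0 : ℝ)..y, ρ x) - ρ y * t| ≤ o * τ := by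
  have hint : ∀ a b, IntervalIntegrable ρ volume a b := fun a b =>
    h.continuous.intervalIntegrable a b
  have ho : 0 ≤ o := (abs_nonneg _).trans (hmod y (by simpa using (abs_nonneg t).trans ht))
  have e : (∫ x in (0 : ℝ)..y + t, ρ x) - (∫ x in (0 : ℝ)..y, ρ x) - ρ y * t =
      ∫ x in y..y + t, (ρ x - ρ y) := by
    rw [intervalIntegral.integral_sub (hint _ _) (by simp),
      ← intervalIntegral.integral_add_adjacent_intervals (hint 0 y) (hint y (y + t))]
    simp
    ring
  rw [e]
  have := intervalIntegral.norm_integral_le_of_norm_le_const (a := y) (b := y + t) (C := o)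
    (f := fun x => ρ x - ρ y) fun x hx => by
      refine hmod x (le_trans ?_ ht)
      have := Set.abs_sub_left_of_mem_uIcc (Set.uIoc_subset_uIcc hx)
      simpa using this
  rw [add_sub_cancel_left] at this
  exact this.trans (mul_le_mul_of_nonneg_left ht ho)

/-- First-order expansion of the lifted cumulative distribution function of a displaced measure: the
displacement `v` lowers it by the flux `ρ v`. -/
theorem abs_liftedCDF_add_sub_le (h : IsLogLipschitzDensity K ρ) {v : ℝ → ℝ} (hc : Continuous v)
    (hper : Function.Periodic v 1) {τ ω o R : ℝ} (hω : 0 ≤ ω) (hτ : ∀ x, |v x| ≤ τ)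
    (hmod : ∀ x y, |x - y| ≤ τ → |v x - v y| ≤ ω)
    (hρmod : ∀ x y, |x - y| ≤ τ + ω → |ρ x - ρ y| ≤ o) (hR : ∀ x, ρ x ≤ R) (y : ℝ) :
    |liftedCDF (densityMeasure ρ) (fun x => x + v x) y -
      ((∫ x in (0 : ℝ)..y, ρ x) - ρ y * v y + -1)| ≤ o * (τ + ω) + R * ω := by
  have := h.isProbabilityMeasure
  have hT : Continuous fun x => x + v x := by fun_prop
  have iT := integrable_floor_sub hT.measurable (h.integrable_densityMeasure hT) y
  have iid := integrable_floor_sub measurable_id (h.integrable_densityMeasure continuous_id)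
  have lo : liftedCDF (densityMeasure ρ) (fun x => x) (y - v y - ω) ≤
      liftedCDF (densityMeasure ρ) (fun x => x + v x) y :=
    integral_mono (iid _) iT fun x => Int.cast_le.2 (floor_sandwich hper hω hτ hmod x y).1
  have hi : liftedCDF (densityMeasure ρ) (fun x => x + v x) y ≤
      liftedCDF (densityMeasure ρ) (fun x => x) (y - v y + ω) :=
    integral_mono iT (iid _) fun x => Int.cast_le.2 (floor_sandwich hper hω hτ hmod x y).2
  rw [h.liftedCDF_id] at lo hi
  have hv := abs_le.1 (hτ y)
  have e1 := abs_le.1 (h.abs_integral_sub_le (y := y) (t := -v y - ω) (τ := τ + ω) (o := o)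
    (abs_le.2 ⟨by linarith, by linarith⟩) fun x hx => hρmod x y hx)
  have e2 := abs_le.1 (h.abs_integral_sub_le (y := y) (t := -v y + ω) (τ := τ + ω) (o := o)
    (abs_le.2 ⟨by linarith, by linarith⟩) fun x hx => hρmod x y hx)
  rw [show y + (-v y - ω) = y - v y - ω by ring] at e1
  rw [show y + (-v y + ω) = y - v y + ω by ring] at e2
  have hRω : ρ y * ω ≤ R * ω := mul_le_mul_of_nonneg_right (hR y) hω
  rw [abs_le]
  constructor <;> linarith

theorem exists_isApproxCDF (h : IsLogLipschitzDensity K ρ) {n : ℕ} {v : Fin n → ℝ → ℝ}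
    (hc : ∀ i, Continuous (v i)) (hp : ∀ i, Function.Periodic (v i) 1) {ε : ℝ} (hε : 0 < ε) :
    ∃ r > 0, ∀ a : EuclideanSpace ℝ (Fin n), ‖a‖ < r →
      IsApproxCDF (densityMeasure ρ) (fun x => x + linearField v a x)
        (fun y => (∫ x in (0 : ℝ)..y, ρ x) - ρ y * linearField v a y) (ε * ‖a‖) := by
  obtain ⟨V, hV0, hV⟩ := exists_abs_linearField_le hc hp
  obtain ⟨R, hR0, hR⟩ := h.periodic.exists_abs_le h.continuous
  set ε₁ := ε / (2 * R) with hε₁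
  have hε₁0 : 0 < ε₁ := by positivity
  obtain ⟨δ₁, hδ₁, hmod⟩ := exists_modulus_linearField hc hp hε₁0
  set o := ε / (2 * (V + ε₁)) with ho
  have ho0 : 0 < o := by positivity
  obtain ⟨δ₂, hδ₂, hρmod⟩ := h.periodic.exists_modulus h.continuous ho0
  refine ⟨min (δ₁ / V) (δ₂ / (V + ε₁)), lt_min (by positivity) (by positivity), fun a ha => ?_⟩
  have ha1 : V * ‖a‖ < δ₁ := by
    rw [← lt_div_iff₀' hV0]; exact ha.trans_le (min_le_left _ _)
  have ha2 : V * ‖a‖ + ε₁ * ‖a‖ < δ₂ := by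
    rw [← add_mul, ← lt_div_iff₀' (by positivity)]; exact ha.trans_le (min_le_right _ _)
  refine ⟨-1, fun y => (h.abs_liftedCDF_add_sub_le (linearField_continuous hc a)
    (linearField_periodic hp a) (τ := V * ‖a‖) (ω := ε₁ * ‖a‖) (o := o) (R := R) (by positivity)
    (hV a) (fun x y hxy => hmod a x y (hxy.trans_lt ha1))
    (fun x y hxy => (hρmod x y (hxy.trans_lt ha2)).le)
    (fun x => (le_abs_self _).trans (hR x)) y).trans (le_of_eq ?_)⟩
  have e1 : o * (V * ‖a‖ + ε₁ * ‖a‖) = ε * ‖a‖ / 2 := by rw [ho]; field_simp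
  have e2 : R * (ε₁ * ‖a‖) = ε * ‖a‖ / 2 := by rw [hε₁]; field_simp
  rw [e1, e2]; ring

end IsLogLipschitzDensity

namespace ExpandingLift

variable (S : ExpandingLift)

/-- Hermite's identity. -/
theorem sum_floor_div (z : ℝ) :
    ∑ j ∈ Finset.range S.D, (⌊(z + j) / S.D⌋ : ℝ) = ⌊z⌋ := by
  have hD0 : (0 : ℝ) < S.D := by have := S.two_le; positivity
  have hF : Function.Periodic (fun z : ℝ => (⌊z / S.D⌋ : ℝ) - z / S.D) S.D := fun z => by
    have : (z + S.D) / S.D = z / S.D + 1 := by field_simp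
    simp only [this, Int.floor_add_one]
    push_cast; ring
  -- the difference of the two sides is periodic in `z`, so `z` may be replaced by `Int.fract z`
  have hG := (S.periodic_sum hF).int_mul ⌊z⌋ (Int.fract z)
  have e : Int.fract z + ⌊z⌋ * 1 = z := by rw [mul_one, add_comm, Int.floor_add_fract]
  simp only [e, Finset.sum_sub_distrib, add_div, Finset.sum_add_distrib, Finset.sum_const,
    Finset.card_range, nsmul_eq_mul] at hG
  have h0 : ∑ j ∈ Finset.range S.D, (⌊Int.fract z / S.D + j / S.D⌋ : ℝ) = 0 := by
    refine Finset.sum_eq_zero fun j hj => ?_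
    have hj' : (j : ℝ) + 1 ≤ S.D := by exact_mod_cast Finset.mem_range.1 hj
    have h1 := Int.fract_nonneg z
    have h2 := Int.fract_lt_one z
    rw [← add_div]
    have : ⌊(Int.fract z + j) / S.D⌋ = 0 := by
      rw [Int.floor_eq_zero_iff]
      refine ⟨by positivity, (div_lt_one hD0).2 (by linarith)⟩
    rw [this, Int.cast_zero]
  rw [h0] at hG
  have e2 : (S.D : ℝ) * (z / S.D) = z := by field_simp
  have e3 : (S.D : ℝ) * (Int.fract z / S.D) = Int.fract z := by field_simp
  rw [e2, e3] at hG
  simp only [add_div]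
  linarith [Int.floor_add_fract z]

variable {S}

/-- Counting the lifts of `f x` below `y` amounts to counting the lifts of `x` below each of the
preimages `ψ (y + j)`. -/
theorem floor_sub_f_of_pos (hσ : S.σ = 1) (x y : ℝ) :
    (⌊y - S.f x⌋ : ℝ) = ∑ j ∈ Finset.range S.D, (⌊S.ψ (y + j) - x⌋ : ℝ) := by
  have hD0 : (0 : ℝ) < S.D := by have := S.two_le; positivity
  have hmono : StrictMono S.ψ := strictMono_of_hasDerivAt_pos S.ψ_deriv fun y => by
    rw [hσ, one_mul]; exact S.p_pos y
  rw [← S.sum_floor_div]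
  refine Finset.sum_congr rfl fun j _ => ?_
  rw [Int.cast_inj]
  refine eq_of_forall_le_iff fun k => ?_
  rw [Int.le_floor, Int.le_floor, le_div_iff₀ hD0, le_sub_iff_add_le', ← S.ψ_f (x + k),
    hmono.le_iff_le, S.f_add_int, hσ]
  constructor <;> intro <;> linarith

/-- The analogue of `floor_sub_f_of_pos` for an orientation-reversing map, where the lifts of `x`
above the preimages are counted. -/
theorem floor_sub_f_of_neg (hσ : S.σ = -1) (x y : ℝ) :
    (⌊y - S.f x⌋ : ℝ) = ∑ j ∈ Finset.range S.D, (⌊x - S.ψ (y + j)⌋ : ℝ) := by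
  have hD0 : (0 : ℝ) < S.D := by have := S.two_le; positivity
  have hanti : StrictAnti S.ψ := strictAnti_of_hasDerivAt_neg S.ψ_deriv fun y => by
    rw [hσ, neg_one_mul]; exact neg_neg_of_pos (S.p_pos y)
  rw [← S.sum_floor_div]
  refine Finset.sum_congr rfl fun j _ => ?_
  rw [Int.cast_inj]
  refine eq_of_forall_le_iff fun k => ?_
  have e : S.f (x - k) = S.f x + S.D * k := by
    have := S.f_add_int x (-k)
    push_cast at this
    rw [sub_eq_add_neg, this, hσ]; ring
  rw [Int.le_floor, Int.le_floor, le_div_iff₀ hD0, le_sub_comm, ← S.ψ_f (x - k),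
    hanti.le_iff_ge, e]
  constructor <;> intro <;> linarith

variable {Ω : Type} [MeasurableSpace Ω] {m : Measure Ω} [IsProbabilityMeasure m]

/-- Pushing forward by the map replaces the lifted cumulative distribution function `N` by
`y ↦ σ * ∑ j, N (ψ (y + j))`, up to a constant and up to left limits when `σ = -1`. Hence it
preserves approximate cumulative distribution functions which are fixed by this operation. -/
theorem isApproxCDF_comp {g : Ω → ℝ} {h : ℝ → ℝ} {η c' : ℝ} (hg : Measurable g)
    (hi : Integrable g m) (hc : Continuous h)
    (hfix : ∀ y, S.σ * ∑ j ∈ Finset.range S.D, h (S.ψ (y + j)) = h y + c')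
    (H : IsApproxCDF m g h η) : IsApproxCDF m (fun ω => S.f (g ω)) h (S.D * η) := by
  obtain ⟨c, H⟩ := H
  have sum_le : ∀ (A : ℕ → ℝ), (∀ j, |A j| ≤ η) → |∑ j ∈ Finset.range S.D, A j| ≤ S.D * η :=
    fun A hA => by
      refine (Finset.abs_sum_le_sum_abs _ _).trans ((Finset.sum_le_sum fun j _ => hA j).trans ?_)
      simp
  rcases S.sign with hσ | hσ
  · refine ⟨c' + S.D * c, fun y => ?_⟩
    have e : liftedCDF m (fun ω => S.f (g ω)) y =
        ∑ j ∈ Finset.range S.D, liftedCDF m g (S.ψ (y + j)) := by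
      unfold liftedCDF
      simp_rw [floor_sub_f_of_pos hσ]
      rw [integral_finsetSum _ fun j _ => integrable_floor_sub hg hi _]
    have e2 := sum_le (fun j => liftedCDF m g (S.ψ (y + j)) - (h (S.ψ (y + j)) + c))
      fun j => H _
    rw [Finset.sum_sub_distrib, ← e, Finset.sum_add_distrib, Finset.sum_const, Finset.card_range,
      nsmul_eq_mul] at e2
    have e3 := hfix y
    rw [hσ, one_mul] at e3
    rwa [e3, add_assoc] at e2
  · -- `∫ ⌊g - z⌋` is the opposite of the left limit at `z` of the lifted CDF, minus one
    have hM : ∀ z, |∫ ω, (⌊g ω - z⌋ : ℝ) ∂m - (-h z - c - 1)| ≤ η := by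
      intro z
      have iM : Integrable (fun ω => (⌊g ω - z⌋ : ℝ)) m := by
        have := integrable_floor_sub hg.neg hi.neg (-z)
        refine this.congr (ae_of_all _ fun ω => ?_)
        simp only [Pi.neg_apply]
        rw [show -z - -g ω = g ω - z by ring]
      have iN := integrable_floor_sub hg hi
      have hneg : ∀ z', ∫ ω, (-(⌊z' - g ω⌋ : ℝ) - 1) ∂m = -liftedCDF m g z' - 1 := fun z' => by
        rw [integral_sub (f := fun ω => -(⌊z' - g ω⌋ : ℝ)) (iN z').neg (integrable_const _),
          integral_neg]
        simp [liftedCDF]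
      have lo : -liftedCDF m g z - 1 ≤ ∫ ω, (⌊g ω - z⌋ : ℝ) ∂m := by
        rw [← hneg]
        refine integral_mono ((iN z).neg.sub (integrable_const _)) iM fun ω => ?_
        have h1 := Int.floor_le (z - g ω)
        have h2 : -⌊z - g ω⌋ - 1 ≤ ⌊g ω - z⌋ := by
          rw [Int.le_floor]; push_cast; linarith [Int.lt_floor_add_one (z - g ω)]
        have h5 := (Int.cast_le (R := ℝ)).2 h2
        push_cast at h5
        exact h5
      have hi' : ∀ δ > 0, ∫ ω, (⌊g ω - z⌋ : ℝ) ∂m ≤ -liftedCDF m g (z - δ) - 1 := by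
        intro δ hδ
        rw [← hneg]
        refine integral_mono iM ((iN _).neg.sub (integrable_const _)) fun ω => ?_
        have h2 : ⌊g ω - z⌋ ≤ -⌊z - δ - g ω⌋ - 1 := by
          have h3 : (⌊z - δ - g ω⌋ : ℝ) + ⌊g ω - z⌋ < 0 := by
            linarith [Int.floor_le (z - δ - g ω), Int.floor_le (g ω - z)]
          have h4 : ⌊z - δ - g ω⌋ + ⌊g ω - z⌋ < 0 := by exact_mod_cast h3
          omega
        have h5 := (Int.cast_le (R := ℝ)).2 h2
        push_cast at h5
        exact h5
      have hi : ∫ ω, (⌊g ω - z⌋ : ℝ) ∂m ≤ -h z - c - 1 + η := by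
        have t : Tendsto (fun δ => -h (z - δ) - c - 1 + η) (𝓝[>] 0) (𝓝 (-h z - c - 1 + η)) := by
          have : Continuous fun δ => -h (z - δ) - c - 1 + η := by fun_prop
          simpa using (this.tendsto 0).mono_left nhdsWithin_le_nhds
        refine ge_of_tendsto t ?_
        filter_upwards [self_mem_nhdsWithin] with δ hδ
        linarith [hi' δ hδ, (abs_le.1 (H (z - δ))).1]
      rw [abs_le]
      constructor
      · linarith [(abs_le.1 (H z)).2]
      · linarith
    refine ⟨c' - S.D * (c + 1), fun y => ?_⟩
    have e : liftedCDF m (fun ω => S.f (g ω)) y =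
        ∑ j ∈ Finset.range S.D, ∫ ω, (⌊g ω - S.ψ (y + j)⌋ : ℝ) ∂m := by
      unfold liftedCDF
      simp_rw [floor_sub_f_of_neg hσ]
      rw [integral_finsetSum _ fun j _ => ?_]
      have := integrable_floor_sub hg.neg hi.neg (-S.ψ (y + j))
      refine this.congr (ae_of_all _ fun ω => ?_)
      simp only [Pi.neg_apply]
      rw [show -S.ψ (y + j) - -g ω = g ω - S.ψ (y + j) by ring]
    have e2 := sum_le (fun j => ∫ ω, (⌊g ω - S.ψ (y + j)⌋ : ℝ) ∂m - (-h (S.ψ (y + j)) - c - 1))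
      fun j => hM _
    rw [Finset.sum_sub_distrib, ← e, Finset.sum_sub_distrib, Finset.sum_sub_distrib,
      Finset.sum_neg_distrib, Finset.sum_const, Finset.sum_const, Finset.card_range,
      nsmul_eq_mul, nsmul_eq_mul] at e2
    have e3 := hfix y
    rw [hσ, neg_one_mul] at e3
    rw [e3] at e2
    convert e2 using 2
    ring

end ExpandingLift

/-! ### The family of displaced measures -/

/-- The image of the measure with density `ρ` under the displacement `x ↦ x + ∑ i, a i * v i x`. -/
noncomputable def displacedMeasure {n : ℕ} (ρ : ℝ → ℝ) (v : Fin n → ℝ → ℝ)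
    (a : EuclideanSpace ℝ (Fin n)) : Measure UnitAddCircle :=
  (densityMeasure ρ).map fun x => ((x + linearField v a x : ℝ) : UnitAddCircle)

theorem displacedMeasure_zero {n : ℕ} (ρ : ℝ → ℝ) (v : Fin n → ℝ → ℝ) :
    displacedMeasure ρ v 0 = circleMeasure ρ := by
  simp only [displacedMeasure, linearField_zero, add_zero, circleMeasure]

section Primitive

variable {ζ : ℝ → ℝ}

theorem primitive_periodic (hc : Continuous ζ) (hp : Function.Periodic ζ 1)
    (h0 : ∫ x in (0 : ℝ)..1, ζ x = 0) :
    Function.Periodic (fun x => ∫ t in (0 : ℝ)..x, ζ t) 1 := fun x => by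
  have hint : ∀ a b, IntervalIntegrable ζ volume a b := fun a b => hc.intervalIntegrable a b
  have h1 := hp.intervalIntegral_add_eq x 0
  rw [zero_add, h0] at h1
  show ∫ t in (0 : ℝ)..x + 1, ζ t = ∫ t in (0 : ℝ)..x, ζ t
  rw [← intervalIntegral.integral_add_adjacent_intervals (hint 0 x) (hint x (x + 1)), h1, add_zero]

theorem primitive_continuous (hc : Continuous ζ) : Continuous fun x => ∫ t in (0 : ℝ)..x, ζ t :=
  intervalIntegral.continuous_primitive (fun a b => hc.intervalIntegrable a b) 0

/-- The primitive of a periodic function of zero mean is a Lipschitz function on the circle, so it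
bounds the Wasserstein distance from below. -/
theorem abs_integral_primitive_sub_le_wasserstein (hc : Continuous ζ)
    (hp : Function.Periodic ζ 1) (h0 : ∫ x in (0 : ℝ)..1, ζ x = 0) {L : ℝ} (hL : 0 < L)
    (hζ : ∀ x, |ζ x| ≤ L) {m : Measure ℝ} [IsProbabilityMeasure m] {T₁ T₂ : ℝ → ℝ}
    (h₁ : Measurable T₁) (h₂ : Measurable T₂) :
    |∫ x, (∫ t in (0 : ℝ)..T₁ x, ζ t) ∂m - ∫ x, (∫ t in (0 : ℝ)..T₂ x, ζ t) ∂m| ≤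
      L * wasserstein (m.map fun x => (T₁ x : UnitAddCircle))
        (m.map fun x => (T₂ x : UnitAddCircle)) := by
  set φ : ℝ → ℝ := fun x => ∫ t in (0 : ℝ)..x, ζ t with hφ
  have φper : Function.Periodic φ 1 := primitive_periodic hc hp h0
  have φc : Continuous φ := primitive_continuous hc
  have φlip : ∀ x y, |φ x - φ y| ≤ L * |x - y| := fun x y => by
    have hint : ∀ a b, IntervalIntegrable ζ volume a b := fun a b => hc.intervalIntegrable a b
    simp only [hφ]
    rw [intervalIntegral.integral_interval_sub_left (hint _ _) (hint _ _)]
    exact intervalIntegral.norm_integral_le_of_norm_le_const (f := ζ) fun z _ => hζ z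
  have φ'c := φper.continuous_lift φc
  have φ'lip : ∀ z w : UnitAddCircle, |(φper.lift : UnitAddCircle → ℝ) z -
      (φper.lift : UnitAddCircle → ℝ) w| ≤ L * dist z w := by
    intro z w
    obtain ⟨x, rfl⟩ := QuotientAddGroup.mk_surjective z
    obtain ⟨y, rfl⟩ := QuotientAddGroup.mk_surjective w
    have hd : dist (x : UnitAddCircle) (y : UnitAddCircle) = |x - (y + round (x - y))| := by
      rw [dist_eq_norm, ← AddCircle.coe_sub, UnitAddCircle.norm_eq, sub_sub]
    have hy : φ (y + round (x - y)) = φ y := by simpa using φper.int_mul (round (x - y)) y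
    have := φlip x (y + round (x - y))
    rw [hy] at this
    exact this.trans_eq (congrArg (L * ·) hd.symm)
  have m₁ : Measurable fun x => (T₁ x : UnitAddCircle) := measurable_coe.comp h₁
  have m₂ : Measurable fun x => (T₂ x : UnitAddCircle) := measurable_coe.comp h₂
  have p₁ : IsProbabilityMeasure (m.map fun x => (T₁ x : UnitAddCircle)) :=
    Measure.isProbabilityMeasure_map m₁.aemeasurable
  have p₂ : IsProbabilityMeasure (m.map fun x => (T₂ x : UnitAddCircle)) :=
    Measure.isProbabilityMeasure_map m₂.aemeasurable
  have := abs_integral_sub_integral_le_wasserstein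
    (μ := m.map fun x => (T₁ x : UnitAddCircle)) (ν := m.map fun x => (T₂ x : UnitAddCircle))
    hL φ'c φ'lip
  have e₁ := integral_map (μ := m) m₁.aemeasurable φ'c.aestronglyMeasurable
  have e₂ := integral_map (μ := m) m₂.aemeasurable φ'c.aestronglyMeasurable
  rw [e₁, e₂] at this
  exact this

/-- First-order expansion of the test function. -/
theorem abs_primitive_sub_le (hc : Continuous ζ) {τ o : ℝ}
    (hmod : ∀ x y, |x - y| ≤ τ → |ζ x - ζ y| ≤ o) {s s' : ℝ} (hs : |s| ≤ τ) (hs' : |s'| ≤ τ)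
    (x : ℝ) :
    |(∫ t in (0 : ℝ)..x + s, ζ t) - (∫ t in (0 : ℝ)..x + s', ζ t) - ζ x * (s - s')| ≤
      o * |s - s'| := by
  have hint : ∀ a b, IntervalIntegrable ζ volume a b := fun a b => hc.intervalIntegrable a b
  have e : (∫ t in (0 : ℝ)..x + s, ζ t) - (∫ t in (0 : ℝ)..x + s', ζ t) - ζ x * (s - s') =
      ∫ t in x + s'..x + s, (ζ t - ζ x) := by
    rw [intervalIntegral.integral_sub (hint _ _) (by simp),
      intervalIntegral.integral_interval_sub_left (hint _ _) (hint _ _)]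
    simp
    ring
  rw [e]
  have := intervalIntegral.norm_integral_le_of_norm_le_const (a := x + s') (b := x + s) (C := o)
    (f := fun t => ζ t - ζ x) fun t ht => by
      refine hmod t x ?_
      have h1 := Set.uIoc_subset_uIcc ht
      rw [Set.mem_uIcc] at h1
      have h2 := abs_le.1 hs
      have h3 := abs_le.1 hs'
      rw [abs_le]
      rcases h1 with h1 | h1 <;> constructor <;> linarith [h1.1, h1.2]
  rwa [add_sub_add_left_eq_sub] at this

end Primitive

section LowerBound

variable {n : ℕ}

/-- The mean over a period of the linear combination of the `u i` with coefficients `a`. -/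
noncomputable def meanField (u : Fin n → ℝ → ℝ) (a : EuclideanSpace ℝ (Fin n)) : ℝ :=
  ∫ x in (0 : ℝ)..1, linearField u a x

/-- If no nontrivial linear combination of the `u i` is constant, then the variance over a period
is a positive definite quadratic form in the coefficients. -/
theorem exists_le_variance {u : Fin n → ℝ → ℝ} (hc : ∀ i, Continuous (u i))
    (hp : ∀ i, Function.Periodic (u i) 1)
    (hind : ∀ (a : EuclideanSpace ℝ (Fin n)) (c : ℝ), (∀ x, linearField u a x = c) → a = 0) :
    ∃ c₀ > 0, ∀ a, c₀ * ‖a‖ ^ 2 ≤ ∫ x in (0 : ℝ)..1, (linearField u a x - meanField u a) ^ 2 := by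
  have hu := linearField_continuous_uncurry hc
  have hmc : Continuous (meanField u) :=
    intervalIntegral.continuous_parametric_intervalIntegral_of_continuous'
      (f := fun a x => linearField u a x) hu 0 1
  set q : EuclideanSpace ℝ (Fin n) → ℝ := fun a =>
    ∫ x in (0 : ℝ)..1, (linearField u a x - meanField u a) ^ 2 with hq
  have hu2 : Continuous fun q : EuclideanSpace ℝ (Fin n) × ℝ =>
      (linearField u q.1 q.2 - meanField u q.1) ^ 2 := (hu.sub (hmc.comp continuous_fst)).pow 2
  have hqc : Continuous q :=
    intervalIntegral.continuous_parametric_intervalIntegral_of_continuous'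
      (f := fun a x => (linearField u a x - meanField u a) ^ 2) hu2 0 1
  have hqs : ∀ (t : ℝ) a, q (t • a) = t ^ 2 * q a := fun t a => by
    have hm : meanField u (t • a) = t * meanField u a := by
      simp only [meanField, linearField_smul, intervalIntegral.integral_const_mul]
    simp only [hq, hm, linearField_smul, ← mul_sub, mul_pow, intervalIntegral.integral_const_mul]
  have hqpos : ∀ a, a ≠ 0 → 0 < q a := fun a ha => by
    have hac := linearField_continuous hc a
    have hex : ∃ x ∈ Set.Icc (0 : ℝ) 1, 0 < (linearField u a x - meanField u a) ^ 2 := by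
      by_contra! hcon
      refine ha (hind a (meanField u a) fun x => ?_)
      have h1 := hcon (Int.fract x) ⟨Int.fract_nonneg x, (Int.fract_lt_one x).le⟩
      have h2 := pow_eq_zero_iff (two_ne_zero) |>.1 (le_antisymm h1 (sq_nonneg _))
      have h3 := (linearField_periodic hp a).int_mul ⌊x⌋ (Int.fract x)
      rw [mul_one, add_comm, Int.floor_add_fract] at h3
      rw [h3]
      linarith
    exact intervalIntegral.integral_pos zero_lt_one (by fun_prop) (fun x _ => sq_nonneg _) hex
  rcases (Metric.sphere (0 : EuclideanSpace ℝ (Fin n)) 1).eq_empty_or_nonempty with hS | hS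
  · refine ⟨1, one_pos, fun a => ?_⟩
    have ha : a = 0 := by
      by_contra hne
      have : (‖a‖⁻¹ • a) ∈ Metric.sphere (0 : EuclideanSpace ℝ (Fin n)) 1 := by
        rw [mem_sphere_zero_iff_norm, norm_smul, norm_inv, norm_norm,
          inv_mul_cancel₀ (norm_ne_zero_iff.2 hne)]
      rw [hS] at this
      exact this
    rw [ha, norm_zero]
    have : 0 ≤ q 0 := intervalIntegral.integral_nonneg zero_le_one fun x _ => sq_nonneg _
    simpa [hq] using this
  · obtain ⟨b, hb, hmin⟩ := (isCompact_sphere (0 : EuclideanSpace ℝ (Fin n)) 1).exists_isMinOn hS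
      hqc.continuousOn
    have hb0 : b ≠ 0 := by
      rintro rfl
      rw [mem_sphere_zero_iff_norm, norm_zero] at hb
      exact zero_ne_one hb
    refine ⟨q b, hqpos b hb0, fun a => ?_⟩
    show q b * ‖a‖ ^ 2 ≤ q a
    by_cases ha : a = 0
    · subst ha
      have h0 := hqs 0 0
      rw [smul_zero] at h0
      rw [h0]
      simp
    · have hn : ‖a‖ ≠ 0 := norm_ne_zero_iff.2 ha
      have hmem : (‖a‖⁻¹ • a) ∈ Metric.sphere (0 : EuclideanSpace ℝ (Fin n)) 1 := by
        rw [mem_sphere_zero_iff_norm, norm_smul, norm_inv, norm_norm, inv_mul_cancel₀ hn]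
      have h1 : q b ≤ q (‖a‖⁻¹ • a) := hmin hmem
      have h2 := hqs ‖a‖ (‖a‖⁻¹ • a)
      rw [smul_inv_smul₀ hn] at h2
      rw [h2, mul_comm]
      exact mul_le_mul_of_nonneg_left h1 (sq_nonneg _)

variable {K : ℝ} {ρ : ℝ → ℝ}

/-- Lower bound in the bi-Lipschitz estimate, for a small multiple of the given vector fields. The
test function for `a` and `b` is the primitive of the centred flux of `a - b`. -/
theorem IsLogLipschitzDensity.exists_le_wasserstein_displacedMeasure
    (h : IsLogLipschitzDensity K ρ) {v : Fin n → ℝ → ℝ}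
    (hc : ∀ i, Continuous (v i)) (hp : ∀ i, Function.Periodic (v i) 1)
    (hind : ∀ (a : Fin n → ℝ) (c : ℝ), (∀ x, ∑ i, a i * (ρ x * v i x) = c) → a = 0) :
    ∃ δ > 0, ∃ c > 0, ∀ a b : EuclideanSpace ℝ (Fin n), ‖a‖ ≤ 1 → ‖b‖ ≤ 1 →
      c * ‖a - b‖ ≤ wasserstein (displacedMeasure ρ (fun i x => δ * v i x) a)
        (displacedMeasure ρ (fun i x => δ * v i x) b) := by
  have := h.isProbabilityMeasure
  set u : Fin n → ℝ → ℝ := fun i x => ρ x * v i x with hu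
  have uc : ∀ i, Continuous (u i) := fun i => h.continuous.mul (hc i)
  have up : ∀ i, Function.Periodic (u i) 1 := fun i => h.periodic.mul (hp i)
  obtain ⟨c₀, hc₀, hvar⟩ := exists_le_variance uc up fun a c hac => by
    ext i
    exact congrFun (hind a c hac) i
  obtain ⟨V, hV0, hV⟩ := exists_abs_linearField_le hc hp
  obtain ⟨U, hU0, hU⟩ := exists_abs_linearField_le uc up
  set ε := c₀ / (2 * V) with hε
  have hε0 : 0 < ε := by positivity
  obtain ⟨d, hd0, hd⟩ := exists_modulus_linearField uc up hε0
  set δ := d / (2 * V) with hδ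
  have hδ0 : 0 < δ := by positivity
  have hδV : δ * V < d := by
    have : δ * V = d / 2 := by rw [hδ]; field_simp
    linarith
  refine ⟨δ, hδ0, δ * c₀ / (4 * U), by positivity, fun a b ha hb => ?_⟩
  by_cases hab : a = b
  · rw [hab, sub_self, norm_zero, mul_zero]
    exact Real.sqrt_nonneg _
  set c := a - b with hcdef
  have hcn : 0 < ‖c‖ := norm_pos_iff.2 (sub_ne_zero.2 hab)
  set ζ : ℝ → ℝ := fun x => linearField u c x - meanField u c with hζ
  have ucc := linearField_continuous uc c
  have vcc := fun a => linearField_continuous hc a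
  have ζc : Continuous ζ := ucc.sub continuous_const
  have ζp : Function.Periodic ζ 1 := fun x => by simp only [hζ, linearField_periodic up c x]
  have ζ0 : ∫ x in (0 : ℝ)..1, ζ x = 0 := by
    simp only [hζ]
    rw [intervalIntegral.integral_sub (ucc.intervalIntegrable _ _) (by simp)]
    simp [meanField]
  have hmean : |meanField u c| ≤ U * ‖c‖ := by
    have := intervalIntegral.norm_integral_le_of_norm_le_const (a := 0) (b := 1)
      (f := linearField u c) fun x _ => hU c x
    simpa [meanField] using this
  have ζb : ∀ x, |ζ x| ≤ 2 * U * ‖c‖ := fun x => by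
    have h1 := abs_sub (linearField u c x) (meanField u c)
    have h2 := hU c x
    linarith
  have hlin : ∀ a x, linearField (fun i x => δ * v i x) a x = δ * linearField v a x := fun a x =>
    linearField_mul_left (fun _ => δ) a x
  have hsmall : ∀ a : EuclideanSpace ℝ (Fin n), ‖a‖ ≤ 1 → ∀ x,
      |δ * linearField v a x| ≤ δ * V := fun a ha x => by
    rw [abs_mul, abs_of_pos hδ0]
    exact mul_le_mul_of_nonneg_left ((hV a x).trans (mul_le_of_le_one_right hV0.le ha)) hδ0.le
  have ζmod : ∀ x y, |x - y| ≤ δ * V → |ζ x - ζ y| ≤ ε * ‖c‖ := fun x y hxy => by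
    simp only [hζ, sub_sub_sub_cancel_right]
    exact hd c x y (hxy.trans_lt hδV)
  have Tc : ∀ a, Continuous fun x => x + δ * linearField v a x := fun a =>
    continuous_id.add (continuous_const.mul (vcc a))
  -- pointwise first-order expansion of the test function
  have hpt : ∀ x, δ * (ζ x * linearField v c x) - ε * ‖c‖ * (δ * (V * ‖c‖)) ≤
      (∫ t in (0 : ℝ)..x + δ * linearField v a x, ζ t) -
        ∫ t in (0 : ℝ)..x + δ * linearField v b x, ζ t := fun x => by
    have h1 := (abs_le.1 (abs_primitive_sub_le ζc ζmod (hsmall a ha x) (hsmall b hb x) x)).1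
    have h2 : δ * linearField v a x - δ * linearField v b x = δ * linearField v c x := by
      rw [hcdef, linearField_sub]; ring
    rw [h2] at h1
    have h3 : |δ * linearField v c x| ≤ δ * (V * ‖c‖) := by
      rw [abs_mul, abs_of_pos hδ0]
      exact mul_le_mul_of_nonneg_left (hV c x) hδ0.le
    have h4 := mul_le_mul_of_nonneg_left h3 (show 0 ≤ ε * ‖c‖ by positivity)
    linarith
  have hφc := primitive_continuous ζc
  have i₁ := h.integrable_densityMeasure (hφc.comp (Tc a))
  have i₂ := h.integrable_densityMeasure (hφc.comp (Tc b))
  have i₃ := h.integrable_densityMeasure (g := fun x => δ * (ζ x * linearField v c x))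
    (continuous_const.mul (ζc.mul (vcc c)))
  have hint := integral_mono (i₃.sub (integrable_const (ε * ‖c‖ * (δ * (V * ‖c‖)))))
    (i₁.sub i₂) hpt
  have e₁ : ∫ x, (δ * (ζ x * linearField v c x) - ε * ‖c‖ * (δ * (V * ‖c‖)))
      ∂(densityMeasure ρ) =
      δ * (∫ x in (0 : ℝ)..1, ζ x ^ 2) - ε * ‖c‖ * (δ * (V * ‖c‖)) := by
    rw [integral_sub i₃ (integrable_const _), integral_const_mul,
      ← h.intervalIntegral_eq_integral_densityMeasure]
    simp only [integral_const, probReal_univ, one_smul]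
    congr 2
    have h1 : ∀ x, ζ x * linearField v c x * ρ x = ζ x ^ 2 + meanField u c * ζ x := fun x => by
      have : linearField u c x = ρ x * linearField v c x := linearField_mul_left ρ c x
      simp only [hζ, this]; ring
    simp_rw [h1]
    have j₁ : IntervalIntegrable (fun x => ζ x ^ 2) volume 0 1 :=
      (ζc.pow 2).intervalIntegrable _ _
    have j₂ : IntervalIntegrable (fun x => meanField u c * ζ x) volume 0 1 :=
      (continuous_const.mul ζc).intervalIntegrable _ _
    rw [intervalIntegral.integral_add j₁ j₂, intervalIntegral.integral_const_mul, ζ0, mul_zero,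
      add_zero]
  have e₂ := integral_sub i₁ i₂
  simp only [Pi.sub_apply, Function.comp_apply] at hint e₂
  rw [e₁, e₂] at hint
  have hW := abs_integral_primitive_sub_le_wasserstein ζc ζp ζ0 (L := 2 * U * ‖c‖)
    (by positivity) ζb (m := densityMeasure ρ) (Tc a).measurable (Tc b).measurable
  have hvc := hvar c
  have hfinal : δ * (c₀ * ‖c‖ ^ 2) / 2 ≤ 2 * U * ‖c‖ * wasserstein
      (displacedMeasure ρ (fun i x => δ * v i x) a)
      (displacedMeasure ρ (fun i x => δ * v i x) b) := by
    simp only [displacedMeasure, hlin]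
    refine le_trans ?_ ((le_abs_self _).trans hW)
    refine le_trans ?_ hint
    have h1 : ε * ‖c‖ * (δ * (V * ‖c‖)) = δ * (c₀ * ‖c‖ ^ 2) / 2 := by
      rw [hε]; field_simp
    have h2 := mul_le_mul_of_nonneg_left hvc hδ0.le
    rw [h1]
    linarith
  rw [← mul_le_mul_iff_right₀ (show 0 < 2 * U * ‖c‖ by positivity)]
  refine le_trans (le_of_eq ?_) hfinal
  field_simp
  ring

theorem IsLogLipschitzDensity.exists_wasserstein_displacedMeasure_le
    (h : IsLogLipschitzDensity K ρ) {v : Fin n → ℝ → ℝ}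
    (hc : ∀ i, Continuous (v i)) (hp : ∀ i, Function.Periodic (v i) 1) :
    ∃ C > 0, ∀ a b : EuclideanSpace ℝ (Fin n),
      wasserstein (displacedMeasure ρ v a) (displacedMeasure ρ v b) ≤ C * ‖a - b‖ := by
  have := h.isProbabilityMeasure
  obtain ⟨V, hV0, hV⟩ := exists_abs_linearField_le hc hp
  refine ⟨V, hV0, fun a b => ?_⟩
  have hm : ∀ a, Measurable fun x => ((x + linearField v a x : ℝ) : UnitAddCircle) := fun a =>
    measurable_coe.comp (measurable_id.add (linearField_continuous hc a).measurable)
  refine wasserstein_map_le (hm a) (hm b) (by positivity) (ae_of_all _ fun x => ?_)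
  refine (dist_coe_le _ _).trans ?_
  rw [add_sub_add_left_eq_sub, ← linearField_sub]
  exact hV _ x

end LowerBound

namespace ExpandingLift

variable {S : ExpandingLift} {K : ℝ} {ρ : ℝ → ℝ}

/-- The primitive of the invariant density is fixed, up to a constant, by the action of the map on
lifted cumulative distribution functions. -/
theorem exists_sum_primitive_eq (hρ : IsLogLipschitzDensity K ρ) (hS : S.transfer ρ = ρ) :
    ∃ c, ∀ y, S.σ * ∑ j ∈ Finset.range S.D, ∫ t in (0 : ℝ)..S.ψ (y + j), ρ t =
      (∫ t in (0 : ℝ)..y, ρ t) + c := by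
  set G : ℝ → ℝ := fun y => ∫ t in (0 : ℝ)..y, ρ t with hG
  have dG : ∀ y, HasDerivAt G (ρ y) y := fun y =>
    (hρ.continuous.integral_hasStrictDerivAt 0 y).hasDerivAt
  have dsum : ∀ y, HasDerivAt (fun y => S.σ * ∑ j ∈ Finset.range S.D, G (S.ψ (y + j)) - G y)
      0 y := fun y => by
    have h1 : ∀ j ∈ Finset.range S.D, HasDerivAt (fun y => G (S.ψ (y + j)))
        (ρ (S.ψ (y + j)) * (S.σ * S.p (y + j))) y := fun j _ =>
      (dG _).comp y ((S.ψ_deriv (y + j)).comp_add_const y j)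
    have h2 := ((HasDerivAt.fun_sum h1).const_mul S.σ).sub (dG y)
    have h3 : S.σ * ∑ j ∈ Finset.range S.D, ρ (S.ψ (y + j)) * (S.σ * S.p (y + j)) - ρ y = 0 := by
      have h4 := congrFun hS y
      rw [transfer_apply] at h4
      rw [← h4, sub_eq_zero, Finset.mul_sum]
      refine Finset.sum_congr rfl fun j _ => ?_
      linear_combination (ρ (S.ψ (y + j)) * S.p (y + j)) * S.σ_mul_σ
    rwa [h3] at h2
  refine ⟨S.σ * ∑ j ∈ Finset.range S.D, G (S.ψ (0 + j)) - G 0, fun y => ?_⟩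
  have := is_const_of_deriv_eq_zero (fun y => (dsum y).differentiableAt) (fun y => (dsum y).deriv)
    y 0
  linarith

variable {n : ℕ} {v : Fin n → ℝ → ℝ} {Φ : UnitAddCircle → UnitAddCircle}

/-- The approximate lifted cumulative distribution function of the displaced measure, primitive of
the density minus flux, is fixed by the action of the map on such functions. -/
theorem exists_sum_primitive_sub_flux_eq (hρ : IsLogLipschitzDensity K ρ)
    (hS : S.transfer ρ = ρ)
    (hfix : ∀ i y, S.σ * ∑ j ∈ Finset.range S.D, ρ (S.ψ (y + j)) * v i (S.ψ (y + j)) =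
      ρ y * v i y) (a : EuclideanSpace ℝ (Fin n)) :
    ∃ c, ∀ y, S.σ * ∑ j ∈ Finset.range S.D, ((∫ t in (0 : ℝ)..S.ψ (y + j), ρ t) -
        ρ (S.ψ (y + j)) * linearField v a (S.ψ (y + j))) =
      ((∫ t in (0 : ℝ)..y, ρ t) - ρ y * linearField v a y) + c := by
  obtain ⟨c, hc⟩ := exists_sum_primitive_eq hρ hS
  refine ⟨c, fun y => ?_⟩
  have h1 : S.σ * ∑ j ∈ Finset.range S.D, ρ (S.ψ (y + j)) * linearField v a (S.ψ (y + j)) =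
      ρ y * linearField v a y := by
    have h2 : ∀ y, ρ y * linearField v a y = ∑ i, a i * (ρ y * v i y) := fun y => by
      rw [linearField, Finset.mul_sum]
      exact Finset.sum_congr rfl fun i _ => by ring
    simp_rw [h2]
    rw [Finset.sum_comm, Finset.mul_sum]
    refine Finset.sum_congr rfl fun i _ => ?_
    rw [← Finset.mul_sum, ← hfix i y]; ring
  rw [Finset.sum_sub_distrib, mul_sub, hc, h1]
  ring

theorem iterate_map_displacedMeasure (hΦ : ∀ x : ℝ, Φ x = (S.f x : UnitAddCircle))
    (hc : ∀ i, Continuous (v i)) (a : EuclideanSpace ℝ (Fin n)) (k : ℕ) :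
    (fun ν : Measure UnitAddCircle => ν.map Φ)^[k] (displacedMeasure ρ v a) =
      (densityMeasure ρ).map
        fun x => ((S.f^[k] (x + linearField v a x) : ℝ) : UnitAddCircle) := by
  induction k with
  | zero => rfl
  | succ k ih =>
    have hm : Measurable fun x => ((S.f^[k] (x + linearField v a x) : ℝ) : UnitAddCircle) :=
      measurable_coe.comp ((S.f_cont.iterate k).measurable.comp
        (measurable_id.add (linearField_continuous hc a).measurable))
    rw [Function.iterate_succ_apply', ih,
      Measure.map_map (continuous_of_lift hΦ).measurable hm]
    congr 1
    ext x
    rw [Function.iterate_succ_apply', Function.comp, hΦ]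

/-- Displaced measures along invariant fields are almost fixed: all the iterated push-forwards have
the same first-order approximate lifted cumulative distribution function. -/
theorem exists_wasserstein_iterate_le (hΦ : ∀ x : ℝ, Φ x = (S.f x : UnitAddCircle))
    (hρ : IsLogLipschitzDensity K ρ) (hK : 0 ≤ K) (hS : S.transfer ρ = ρ)
    (hc : ∀ i, Continuous (v i)) (hp : ∀ i, Function.Periodic (v i) 1)
    (hfix : ∀ i y, S.σ * ∑ j ∈ Finset.range S.D, ρ (S.ψ (y + j)) * v i (S.ψ (y + j)) =
      ρ y * v i y) {ε : ℝ} (hε : 0 < ε) (N : ℕ) :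
    ∃ r > 0, ∀ k ≤ N, ∀ a : EuclideanSpace ℝ (Fin n), ‖a‖ < r →
      wasserstein ((fun ν : Measure UnitAddCircle => ν.map Φ)^[k] (displacedMeasure ρ v a))
        (displacedMeasure ρ v a) ≤ ε * ‖a‖ := by
  have := hρ.isProbabilityMeasure
  have hD1 : (1 : ℝ) ≤ S.D := by have := S.two_le; exact_mod_cast (by omega : 1 ≤ S.D)
  set ρ₀ := Real.exp (-K) with hρ₀
  have hρ₀0 : 0 < ρ₀ := Real.exp_pos _
  set ε₁ := ρ₀ * ε / (4 * S.D ^ N) with hε₁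
  have hε₁0 : 0 < ε₁ := by positivity
  obtain ⟨r₁, hr₁, happ⟩ := hρ.exists_isApproxCDF hc hp hε₁0
  obtain ⟨d, hd0, hd⟩ := exists_modulus_linearField (v := fun i x => ρ x * v i x)
    (fun i => hρ.continuous.mul (hc i)) (fun i => hρ.periodic.mul (hp i))
    (show 0 < ρ₀ * ε / 2 by positivity)
  refine ⟨min r₁ (d / ε), lt_min hr₁ (by positivity), fun k hk a ha => ?_⟩
  have ha1 := ha.trans_le (min_le_left _ _)
  have ha2 : ε * ‖a‖ < d := by
    rw [← lt_div_iff₀' hε]; exact ha.trans_le (min_le_right _ _)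
  have vc := linearField_continuous hc a
  set T : ℝ → ℝ := fun x => x + linearField v a x with hT
  have Tc : Continuous T := continuous_id.add vc
  set G : ℝ → ℝ := fun y => (∫ x in (0 : ℝ)..y, ρ x) - ρ y * linearField v a y with hG
  have Gc : Continuous G := (primitive_continuous hρ.continuous).sub (hρ.continuous.mul vc)
  have hTk : ∀ k, Continuous fun x => S.f^[k] (T x) := fun k => (S.f_cont.iterate k).comp Tc
  obtain ⟨c', hc'⟩ := exists_sum_primitive_sub_flux_eq hρ hS hfix a
  have hk' : ∀ k, IsApproxCDF (densityMeasure ρ) (fun x => S.f^[k] (T x)) G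
      (S.D ^ k * (ε₁ * ‖a‖)) := fun k => by
    induction k with
    | zero => rw [pow_zero, one_mul]; exact happ a ha1
    | succ k ih =>
      simp_rw [Function.iterate_succ_apply']
      rw [pow_succ', mul_assoc]
      exact isApproxCDF_comp (hTk k).measurable (hρ.integrable_densityMeasure (hTk k)) Gc hc' ih
  have hmono : ∀ k ≤ N, IsApproxCDF (densityMeasure ρ) (fun x => S.f^[k] (T x)) G
      (S.D ^ N * (ε₁ * ‖a‖)) := fun k hk => by
    obtain ⟨c, hck⟩ := hk' k
    refine ⟨c, fun y => (hck y).trans ?_⟩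
    exact mul_le_mul_of_nonneg_right (pow_le_pow_right₀ hD1 hk) (by positivity)
  rw [iterate_map_displacedMeasure hΦ hc]
  refine (hmono k hk).wasserstein_le (hmono 0 (Nat.zero_le _)) (hTk k).measurable
    (hTk 0).measurable (hρ.integrable_densityMeasure (hTk k))
    (hρ.integrable_densityMeasure (hTk 0)) (by positivity) fun y => ?_
  set s := ε * ‖a‖ with hs
  have hs0 : 0 ≤ s := by positivity
  have e1 : 2 * (S.D ^ N * (ε₁ * ‖a‖)) = ρ₀ * s / 2 := by
    rw [hε₁, hs]; field_simp; ring
  have hint : ∀ a b, IntervalIntegrable ρ volume a b := fun a b =>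
    hρ.continuous.intervalIntegrable a b
  have e2 : ρ₀ * s ≤ (∫ x in (0 : ℝ)..y + s, ρ x) - ∫ x in (0 : ℝ)..y, ρ x := by
    rw [intervalIntegral.integral_interval_sub_left (hint _ _) (hint _ _)]
    have : ∫ _ in y..y + s, ρ₀ ≤ ∫ x in y..y + s, ρ x :=
      intervalIntegral.integral_mono_on (by linarith) (by simp) (hint _ _)
        fun x _ => hρ.exp_neg_le hK x
    rw [intervalIntegral.integral_const, add_sub_cancel_left, smul_eq_mul, mul_comm] at this
    exact this
  have e3 := hd a (y + s) y (by rw [add_sub_cancel_left, abs_of_nonneg hs0]; exact ha2)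
  rw [linearField_mul_left, linearField_mul_left] at e3
  have e4 := (abs_le.1 e3).2
  have e5 : ρ₀ * ε / 2 * ‖a‖ = ρ₀ * s / 2 := by rw [hs]; ring
  rw [e1]
  simp only [hG]
  linarith

end ExpandingLift

theorem mainTheorem4 (Φ : UnitAddCircle → UnitAddCircle) (hΦ : IsC2Expanding Φ) :
    (∃! μ : ProbabilityMeasure UnitAddCircle, IsACInvariant Φ (μ : Measure UnitAddCircle)) ∧
    ∀ μ : ProbabilityMeasure UnitAddCircle, IsACInvariant Φ (μ : Measure UnitAddCircle) →
      ∀ n : ℕ, ∃ F : EuclideanSpace ℝ (Fin n) → ProbabilityMeasure UnitAddCircle,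
        IsBiLipschitzEmbeddingOn F (Metric.closedBall 0 1) ∧
        F 0 = μ ∧
        (fun a : EuclideanSpace ℝ (Fin n) =>
            wasserstein ((F a : Measure UnitAddCircle).map Φ) (F a : Measure UnitAddCircle))
          =o[𝓝[Metric.closedBall 0 1] 0] (fun a : EuclideanSpace ℝ (Fin n) => ‖a‖) ∧
        ∀ ε > (0 : ℝ), ∀ K : ℕ, ∃ r > (0 : ℝ), ∀ k ≤ K,
          ∀ a ∈ Metric.closedBall (0 : EuclideanSpace ℝ (Fin n)) 1, ‖a‖ < r →
            wasserstein ((fun ν : Measure UnitAddCircle => ν.map Φ)^[k] (F a))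
              (F a : Measure UnitAddCircle) ≤ ε * ‖a‖ := by
  obtain ⟨S, hlift⟩ := hΦ.exists_expandingLift
  obtain ⟨ρ, hρ, hS⟩ := S.exists_invariant_density
  have hK : 0 ≤ S.logLip := zero_le_one.trans S.one_le_logLip
  have hprob := hρ.isProbabilityMeasure
  refine ⟨⟨⟨circleMeasure ρ, hρ.isProbabilityMeasure_circleMeasure⟩,
    ExpandingLift.circleMeasure_isACInvariant hlift hρ hS, fun ν hν => Subtype.ext
      (ExpandingLift.eq_circleMeasure_of_isACInvariant (ν := ν.toMeasure) hlift hρ hS hν)⟩,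
    fun μ hμ n => ?_⟩
  have hμρ := ExpandingLift.eq_circleMeasure_of_isACInvariant hlift hρ hS hμ
  obtain ⟨v, vc, vp, vfix, vind⟩ := ExpandingLift.exists_invariant_fields hρ hS n
  obtain ⟨δ, -, c, hc0, hlow⟩ := hρ.exists_le_wasserstein_displacedMeasure vc vp vind
  set w : Fin n → ℝ → ℝ := fun i x => δ * v i x with hw
  have wc : ∀ i, Continuous (w i) := fun i => continuous_const.mul (vc i)
  have wp : ∀ i, Function.Periodic (w i) 1 := fun i x => by simp only [hw, vp i x]
  have wfix : ∀ i y, S.σ * ∑ j ∈ Finset.range S.D, ρ (S.ψ (y + j)) * w i (S.ψ (y + j)) =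
      ρ y * w i y := fun i y => by
    simp only [hw, mul_left_comm _ δ]
    rw [← Finset.mul_sum, mul_left_comm, vfix]
  obtain ⟨C, hC0, hup⟩ := hρ.exists_wasserstein_displacedMeasure_le wc wp
  have hclose := fun {ε : ℝ} (hε : 0 < ε) (N : ℕ) =>
    ExpandingLift.exists_wasserstein_iterate_le hlift hρ hK hS wc wp wfix hε N
  have wm : ∀ a, Measurable fun x => ((x + linearField w a x : ℝ) : UnitAddCircle) := fun a =>
    measurable_coe.comp (measurable_id.add (linearField_continuous wc a).measurable)
  refine ⟨fun a => ⟨displacedMeasure ρ w a, Measure.isProbabilityMeasure_map (wm a).aemeasurable⟩,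
    ⟨c, hc0, C, hC0, fun a ha b hb => ⟨?_, hup a b⟩⟩, ?_, ?_, ?_⟩
  · exact hlow a b (mem_closedBall_zero_iff.1 ha) (mem_closedBall_zero_iff.1 hb)
  · exact Subtype.ext ((displacedMeasure_zero ρ w).trans hμρ.symm)
  · refine isLittleO_iff.2 fun ε hε => ?_
    obtain ⟨r, hr, h⟩ := hclose hε 1
    filter_upwards [nhdsWithin_le_nhds (Metric.ball_mem_nhds 0 hr)] with a ha
    rw [norm_norm, Real.norm_of_nonneg (by exact Real.sqrt_nonneg _)]
    exact h 1 le_rfl a (mem_ball_zero_iff.1 ha)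
  · intro ε hε N
    obtain ⟨r, hr, h⟩ := hclose hε N
    exact ⟨r, hr, fun k hk a _ ha => h k hk a ha⟩
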